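/- A $*$-probability space $(\mathcal A,\varphi)$ is a unital complex $*$-algebra $\mathcal A$ with a linear functional $\varphi:\mathcal A\to\mathbb C$, $\varphi(1)=1$. Let $\mathcal M_n$ be the $*$-algebra of $n\times n$ random complex matrices whose entries have finite moments of all orders, with $\varphi_n=n^{-1}\mathbb E\,\mathrm{Tr}$. Let $(c_j)_{j\ge 0}$ be independent (real or complex) random variables on a probability space with $\mathbb E c_j=0$, $\mathbb E|c_j|^2=1$ and $\sup_j\mathbb E|c_j|^p<\infty$ for every $p\in\mathbb N$, and let $C_n=(c_{(j-i)\bmod n})_{0\le i,j\le n-1}$. Let $\theta\in[-\pi,\pi]$, $\eta=e^{i\theta/n}$ and $D_n(\theta)=\mathrm{diag}(1,\eta,\dots,\eta^{n-1})$. **Theorem.** There are a $*$-probability space $(\mathcal A,\varphi)$ and $N,d\in\mathcal A$ such that the following hold. 1. For every monomial $Q$ in two non-commuting letters and their adjoints, $\lim_{n\to\infty}\varphi_n\big(Q(n^{-1/2}C_n,D_n(\theta))\big)=\varphi(Q(N,d))$. 2. $N$ is a standard complex Gaussian variable: it is normal, not self-adjoint, and $\varphi(N^kN^{*l})=\mathbb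 E(Z^k\overline Z^{\,l})$ for all $k,l\ge0$, where $Z=X+iY$ with $X,Y$ independent real Gaussian of mean $0$ and variance $1/2$. 3. $d=d(\theta)$ is distributed as $e^{i\theta U}$ with $U$ uniform on $[0,1]$: it is normal and $\varphi(d^kd^{*l})=\mathbb E\,e^{i\theta(k-l)U}$ for all $k,l\ge 0$. 4. Every monomial in $N,N^*,d,d^*$ can be written as $Q=d^{(0)}N^{\epsilon_1}d^{(1)}N^{\epsilon_2}d^{(2)}\cdots N^{\epsilon_p}d^{(p)}$ with $p\ge0$, $\epsilon_s\in\{1,*\}$ and each $d^{(r)}$ a (possibly empty) monomial in $d,d^*$; let $k_r\in\mathbb Z$ be the number of factors $d$ minus the number of factors $d^*$ in $d^{(r)}$. If $p$ is odd then $\varphi(Q)=0$. If $p=2m$, then $$\varphi(Q)=\sum_{\pi}\int_{[0,1]^{m+1}}\exp\Big(i\theta\sum_{r=0}^{2m}k_r\{\ell^\pi_r(x)\}\Big)\,dx ,$$ where the sum is over the pair partitions $\pi$ of $\{1,\dots,2m\}$ with $\epsilon_s\ne\epsilon_t$ for each block $\{s,t\}\in\pi$, $\{\cdot\}$ is the fractional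 part, the $m+1$ variables are $x_0$ and one variable $x_B$ for each block $B$ of $\pi$, and $\ell^\pi_r(x)=x_0+\sum_{s=1}^{r}\sigma_s x_{B(s)}$, with $B(s)$ the block of $s$, $\sigma_s=1$ if $\epsilon_s=1$ and $\sigma_s=-1$ if $\epsilon_s=*$. -/

import Mathlib

open MeasureTheory ProbabilityTheory Filter Topology

/-- A non-commutative `*`-probability space: a unital complex `*`-algebra together with a
state, i.e. a complex linear functional sending `1` to `1`. -/
structure StarProbSpace where
  carrier : Type*
  [ring : Ring carrier]
  [starRing : StarRing carrier]
  [algebra : Algebra ℂ carrier]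
  [starModule : StarModule ℂ carrier]
  state : carrier →ₗ[ℂ] ℂ
  state_one : state 1 = 1

attribute [instance] StarProbSpace.ring StarProbSpace.starRing StarProbSpace.algebra
  StarProbSpace.starModule

/-- `starPow a false = a` and `starPow a true = a*`. -/
def starPow {A : Type*} [Star A] (a : A) (e : Bool) : A := if e then star a else a

/-- The value at the family `a` of the monomial in the non-commuting letters `x i`, `(x i)*`
given by the word `w`; the letter `(i, false)` is `x i` and `(i, true)` is `(x i)*`. -/
def starMonomial {A ι : Type*} [Monoid A] [Star A] (a : ι → A) (w : List (ι × Bool)) : A :=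
  (w.map fun l => starPow (a l.1) l.2).prod

/-- The value at `a` of a monomial in one letter and its adjoint. -/
def starMonomialOne {A : Type*} [Monoid A] [Star A] (a : A) (w : List Bool) : A :=
  (w.map fun e => starPow a e).prod

/-- Joint convergence in `*`-distribution: all joint `*`-moments converge. -/
def ConvergesInStarDistribution {ι : Type*} (A : ℕ → StarProbSpace)
    (a : ∀ n, ι → (A n).carrier) (B : StarProbSpace) (b : ι → B.carrier) : Prop :=
  ∀ w : List (ι × Bool),
    Tendsto (fun n => (A n).state (starMonomial (a n) w)) atTop
      (𝓝 (B.state (starMonomial b w)))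

/-- The variable `a` is normal and its `*`-moments are those of the probability law `ν` on `ℂ`. -/
def HasStarLaw (A : StarProbSpace) (a : A.carrier) (ν : Measure ℂ) : Prop :=
  IsStarNormal a ∧
    ∀ k l : ℕ, A.state (a ^ k * star a ^ l) = ∫ z, z ^ k * (starRingEnd ℂ z) ^ l ∂ν

/-- The law of `X + iY` with `X`, `Y` independent real Gaussian, mean `0` and variance `1/2`. -/
noncomputable def stdComplexGaussianLaw : Measure ℂ :=
  ((gaussianReal 0 (1 / 2)).prod (gaussianReal 0 (1 / 2))).map
    (fun p : ℝ × ℝ => (p.1 : ℂ) + (p.2 : ℂ) * Complex.I)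

/-- A standard complex Gaussian variable of a `*`-probability space. -/
def IsStdComplexGaussian (A : StarProbSpace) (a : A.carrier) : Prop :=
  ¬ IsSelfAdjoint a ∧ HasStarLaw A a stdComplexGaussianLaw

/-- The law of `exp(iθU)` with `U` uniform on `[0,1]`. -/
noncomputable def expUniformLaw (θ : ℝ) : Measure ℂ :=
  ((volume : Measure ℝ).restrict (Set.Icc 0 1)).map
    (fun u : ℝ => Complex.exp (Complex.I * θ * u))

section RandomMatrices

variable {Ω : Type*} [MeasurableSpace Ω]

/-- The `*`-algebra of random `n × n` complex matrices all of whose entries have finite moments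
of all orders. -/
def randomMatrices (μ : Measure Ω) [IsProbabilityMeasure μ] (n : ℕ) :
    StarSubalgebra ℂ (Ω → Matrix (Fin n) (Fin n) ℂ) where
  carrier := {X | ∀ i j, ∀ p : ℕ, MemLp (fun ω => X ω i j) p μ}
  mul_mem' := by
    intro X Y hX hY i j p
    have h : (fun ω => (X * Y) ω i j) = fun ω => ∑ k, X ω i k * Y ω k j := by
      funext ω
      simp [Matrix.mul_apply]
    rw [h]
    refine memLp_finsetSum _ fun k _ => ?_
    have h1 := hX i k (2 * p)
    have h2 := hY k j (2 * p)
    have hh : ENNReal.HolderTriple ((2 * p : ℕ) : ENNReal) ((2 * p : ℕ) : ENNReal) (p : ENNReal) := by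
      constructor
      push_cast
      rw [ENNReal.mul_inv (by simp) (by simp), ← add_mul, ENNReal.inv_two_add_inv_two, one_mul]
    exact h2.mul' h1
  one_mem' := by
    intro i j p
    exact memLp_const ((1 : Matrix (Fin n) (Fin n) ℂ) i j)
  add_mem' := by
    intro X Y hX hY i j p
    exact (hX i j p).add (hY i j p)
  zero_mem' := by
    intro i j p
    exact memLp_const (0 : ℂ)
  algebraMap_mem' := by
    intro r i j p
    exact memLp_const (algebraMap ℂ (Matrix (Fin n) (Fin n) ℂ) r i j)
  star_mem' := by
    intro X hX i j p
    exact (hX j i p).star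

/-- The random matrices with the state `φ_n = n⁻¹ E Tr`. -/
noncomputable def randomMatrixSpace (μ : Measure Ω) [IsProbabilityMeasure μ] (n : ℕ) [NeZero n] :
    StarProbSpace where
  carrier := randomMatrices μ n
  state :=
    { toFun := fun X => (n : ℂ)⁻¹ * ∫ ω, (X.1 ω).trace ∂μ
      map_add' := by
        intro X Y
        have hi : ∀ Z : randomMatrices μ n, Integrable (fun ω => (Z.1 ω).trace) μ := fun Z =>
          integrable_finsetSum _ fun i _ => memLp_one_iff_integrable.1 (by simpa using Z.2 i i 1)
        have h : (fun ω => ((X + Y).1 ω).trace)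
            = fun ω => (X.1 ω).trace + (Y.1 ω).trace := by
          funext ω
          exact Matrix.trace_add _ _
        rw [h, integral_add (hi X) (hi Y), mul_add]
      map_smul' := by
        intro r X
        have h : (fun ω => ((r • X).1 ω).trace) = fun ω => r * (X.1 ω).trace := by
          funext ω
          exact Matrix.trace_smul r (X.1 ω)
        rw [h, integral_const_mul]
        simp only [RingHom.id_apply, smul_eq_mul]
        ring }
  state_one := by
    have h : (fun ω => ((1 : randomMatrices μ n).1 ω).trace) = fun _ => (n : ℂ) := by
      funext ω
      exact (Matrix.trace_one (n := Fin n) (R := ℂ)).trans (by simp)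
    change (n : ℂ)⁻¹ * ∫ ω, ((1 : randomMatrices μ n).1 ω).trace ∂μ = 1
    rw [h]
    simp [NeZero.ne n]

/-- The input random variables are independent, with mean zero, unit variance, and moments of
every order bounded uniformly over the sequence. Real inputs are viewed in `ℂ`. -/
structure AssumptionI (μ : Measure Ω) (c : ℕ → Ω → ℂ) : Prop where
  measurable : ∀ j, Measurable (c j)
  indep : iIndepFun c μ
  mean : ∀ j, ∫ ω, c j ω ∂μ = 0
  variance : ∀ j, ∫ ω, ‖c j ω‖ ^ 2 ∂μ = 1
  memLp : ∀ (j p : ℕ), MemLp (c j) p μ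
  bounded : ∀ p : ℕ, ∃ B : ℝ, ∀ j, ∫ ω, ‖c j ω‖ ^ p ∂μ ≤ B

/-- The circulant matrix with `(i, j)` entry `c_{(j - i) mod n}`, `0 ≤ i, j ≤ n - 1`. -/
def circ (c : ℕ → ℂ) (n : ℕ) : Matrix (Fin n) (Fin n) ℂ :=
  Matrix.of fun i j => c (((j : ℕ) + n - (i : ℕ)) % n)

/-- The diagonal matrix `D_n(θ)` with entries `η^j`, `0 ≤ j ≤ n - 1`, where `η = exp(iθ/n)`. -/
noncomputable def diagD (θ : ℝ) (n : ℕ) : Matrix (Fin n) (Fin n) ℂ :=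
  Matrix.diagonal fun j => Complex.exp (Complex.I * θ / n) ^ (j : ℕ)

variable {μ : Measure Ω} [IsProbabilityMeasure μ]

/-- `n^{-1/2} C_n` as an element of the `*`-probability space of random matrices. -/
noncomputable def scaledCirculant {c : ℕ → Ω → ℂ} (hc : AssumptionI μ c) (n : ℕ) [NeZero n] :
    (randomMatrixSpace μ n).carrier :=
  ((Real.sqrt n : ℂ)⁻¹) •
    (⟨fun ω => circ (fun j => c j ω) n, fun _ _ p => hc.memLp _ p⟩ : randomMatrices μ n)

/-- `D_n(θ)` as a (deterministic) element of the `*`-probability space of random matrices. -/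
noncomputable def deterministicD (μ : Measure Ω) [IsProbabilityMeasure μ] (θ : ℝ) (n : ℕ)
    [NeZero n] : (randomMatrixSpace μ n).carrier :=
  (⟨fun _ => diagD θ n, fun i j _ => memLp_const (diagD θ n i j)⟩ : randomMatrices μ n)

end RandomMatrices

section JointMoments

/-- The pair partitions of `{0, …, p - 1}`, as involutions without fixed points: `π s = t` means
that `{s, t}` is a block. -/
abbrev PairPartition (p : ℕ) : Type :=
  {π : Equiv.Perm (Fin p) // ∀ s, π (π s) = s ∧ π s ≠ s}

/-- The pair partitions every block of which joins an unstarred position (`ε s = false`) and a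
starred position (`ε s = true`). -/
abbrev MixedPairPartition {p : ℕ} (ε : Fin p → Bool) : Type :=
  {π : PairPartition p // ∀ s, ε (π.1 s) ≠ ε s}

/-- The integration variables: `none` is the base point and `some s`, with `s` unstarred, is the
variable of the block of `s`. -/
abbrev FreeIndex {p : ℕ} (ε : Fin p → Bool) : Type := Option {s : Fin p // ε s = false}

/-- A block of a mixed pair partition has exactly one unstarred element, so that for `p = 2m`
there are `m + 1` integration variables. -/
theorem card_freeIndex {m : ℕ} {ε : Fin (2 * m) → Bool} (π : MixedPairPartition ε) :
    Fintype.card (FreeIndex ε) = m + 1 := by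
  have e : {s : Fin (2 * m) // ε s = false} ≃ {s : Fin (2 * m) // ¬ ε s = false} :=
    { toFun := fun s => ⟨π.1.1 s.1, fun h => π.2 s.1 (h.trans s.2.symm)⟩
      invFun := fun s => ⟨π.1.1 s.1, by
        have h1 := π.2 s.1
        have h2 := s.2
        revert h1 h2
        cases ε (π.1.1 s.1) <;> cases ε s.1 <;> simp⟩
      left_inv := fun s => Subtype.ext (π.1.2 s.1).1
      right_inv := fun s => Subtype.ext (π.1.2 s.1).1 }
  have h1 := Fintype.card_congr e
  have h2 := Fintype.card_subtype_compl (fun s : Fin (2 * m) => ε s = false)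
  have h3 := Fintype.card_subtype_le (fun s : Fin (2 * m) => ε s = false)
  rw [Fintype.card_option]
  simp only [Fintype.card_fin] at h2 h3
  omega

/-- The increment of step `s`: the variable of the block of `s`, with sign `+` if `s` is unstarred
and `-` if `s` is starred. -/
def increment {p : ℕ} {ε : Fin p → Bool} (π : MixedPairPartition ε) (x : FreeIndex ε → ℝ)
    (s : Fin p) : ℝ :=
  if h : ε s = false then x (some ⟨s, h⟩)
  else -x (some ⟨π.1.1 s, by
    have h1 := π.2 s
    revert h1 h
    cases ε (π.1.1 s) <;> cases ε s <;> simp⟩)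

/-- The linear form `l_r(x) = x_none + ∑_{s < r} increment s`, for `r = 0, …, p`. -/
def linearForm {p : ℕ} {ε : Fin p → Bool} (π : MixedPairPartition ε) (x : FreeIndex ε → ℝ)
    (r : Fin (p + 1)) : ℝ :=
  x none + ∑ s : Fin p, if (s : ℕ) < (r : ℕ) then increment π x s else 0

/-- The integer `k` with `D^{v_1} D^{v_2} ⋯ = D^k` for a unitary `D`. -/
def netExponent (v : List Bool) : ℤ := (v.count false : ℤ) - (v.count true : ℤ)

/-- The integral over the unit cube of `exp(iθ ∑_r k_r {l_r(x)})`, where `{·}` is the fractional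
part. -/
noncomputable def pairingIntegral (θ : ℝ) {p : ℕ} {ε : Fin p → Bool} (π : MixedPairPartition ε)
    (k : Fin (p + 1) → ℤ) : ℂ :=
  ∫ x in Set.Icc (0 : FreeIndex ε → ℝ) 1,
    Complex.exp (Complex.I * θ * ((∑ r, (k r : ℝ) * Int.fract (linearForm π x r) : ℝ) : ℂ))

/-- The monomial `d^{(0)} N^{ε_1} d^{(1)} N^{ε_2} d^{(2)} ⋯ N^{ε_p} d^{(p)}`, where `d^{(r)}` is the
monomial `v r` in `d` and `d*`. Every monomial in `N, N*, d, d*` has this form. -/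
def alternatingMonomial {A : Type*} [Monoid A] [Star A] (N d : A) {p : ℕ} (ε : Fin p → Bool)
    (v : Fin (p + 1) → List Bool) : A :=
  starMonomialOne d (v 0) *
    (List.ofFn fun s : Fin p => starPow N (ε s) * starMonomialOne d (v s.succ)).prod

end JointMoments

/-! ### Traces of words as sums over closed walks in `Fin n`. -/

section PathExpansion

/-! A circulant matrix is a combination of translations of `ℤ/n`, and its adjoint translates
backwards. So the trace of a word with `p` circulant letters is `n^{-p/2}` times a sum over base
points `a` and steps `j : Fin p → Fin n` whose signed sum is zero (`trace_alternatingMonomial`). The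
diagonal letters contribute only a phase of modulus one, read off along the walk.

After expectation, independence and mean zero kill every tuple `j` with an isolated value, so a
surviving tuple has at most `p/2` distinct values. Tuples with fewer are too rare to matter. If
there are exactly `p/2`, the values define a pair partition. When some block joins two letters of
the same type, the closing condition determines twice the step of that block, hence the step up to
two choices, and a factor `n` is lost (`card_unmixedAt_le`). When every block is mixed, the walk
closes by itself and the moment is a product of `E|c|² = 1`. `excess` measures the difference
between the true weight of `j` and this pairing count. It vanishes off the negligible tuples and is
bounded on them, so its total contribution is `O(n^{-1/2})`.

What remains, for each mixed pair partition, is a sum over a base point and one step per block,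
normalized by exactly the volume of a grid cell. Reduction modulo `n` becomes the fractional part,
so this is a Riemann sum for `pairingIntegral` (`tendsto_pairingIntegral`). The integrand jumps only
where a nonzero linear form is an integer, which is a null set.

The limit space is the `*`-algebra generated by the two sequences of matrices, with the limit of
normalized expected traces as state. Normality is then inherited from the matrices. The sequences
are functions of the input sequence rather than of the sample point, so the carrier does not depend
on `Ω` and lies in the lowest universe. The law of `N` comes from counting mixed pair partitions,
that of `d` from the case `p = 0`. -/

/-- The step `j`, taken forwards at an unstarred position and backwards at a starred one. -/
def signed {G : Type*} [Neg G] (e : Bool) (j : G) : G := if e then -j else j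

/-- The position of the walk with base point `a` and steps `signed (ε s) (j s)` at time `r`. -/
def walk {G : Type*} [AddCommGroup G] {p : ℕ} (ε : Fin p → Bool) (a : G) (j : Fin p → G)
    (r : Fin (p + 1)) : G :=
  a + ∑ s : Fin p, if (s : ℕ) < (r : ℕ) then signed (ε s) (j s) else 0

/-- The phase `exp(iθ ∑ r, k r * y r)`. -/
noncomputable def phase (θ : ℝ) {q : ℕ} (k : Fin q → ℤ) (y : Fin q → ℝ) : ℂ :=
  Complex.exp (Complex.I * θ * ((∑ r, (k r : ℝ) * y r : ℝ) : ℂ))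

theorem phase_eq_prod (θ : ℝ) {q : ℕ} (k : Fin q → ℤ) (y : Fin q → ℝ) :
    phase θ k y = ∏ r, Complex.exp (Complex.I * θ * ((k r : ℝ) * y r : ℝ)) := by
  rw [phase, ← Complex.exp_sum, Complex.ofReal_sum, Finset.mul_sum]

theorem norm_phase (θ : ℝ) {q : ℕ} (k : Fin q → ℤ) (y : Fin q → ℝ) : ‖phase θ k y‖ = 1 := by
  rw [phase, mul_assoc, ← Complex.ofReal_mul, mul_comm, Complex.norm_exp_ofReal_mul_I]

theorem walk_zero {G : Type*} [AddCommGroup G] {p : ℕ} (ε : Fin p → Bool) (a : G)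
    (j : Fin p → G) : walk ε a j 0 = a := by
  simp [walk]

/-- The first step can be absorbed into the base point; this drives the induction in
`prod_apply_eq_sum_walks`. -/
theorem walk_cons_succ {G : Type*} [AddCommGroup G] {p : ℕ} (ε : Fin (p + 1) → Bool) (a i : G)
    (j : Fin p → G) (r : Fin (p + 1)) :
    walk ε a (Fin.cons i j : Fin (p + 1) → G) r.succ
      = walk (fun s => ε s.succ) (a + signed (ε 0) i) j r := by
  rw [walk, walk, Fin.sum_univ_succ]
  simp only [Fin.val_succ, Fin.val_zero, Nat.succ_pos, if_true, Fin.cons_zero, Fin.cons_succ,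
    add_assoc, Nat.add_lt_add_iff_right]

/-- Each `X s` is a weighted sum of translations of `G`, so a path in the matrix product is
determined by its start and its steps. Indexing by steps rather than vertices is what lets the
weights `f s (j s)` ignore the position. -/
theorem prod_apply_eq_sum_walks {G : Type*} [AddCommGroup G] [Fintype G] [DecidableEq G]
    {p : ℕ} (ε : Fin p → Bool) (f : Fin p → G → ℂ) (X : Fin p → Matrix G G ℂ)
    (hX : ∀ s a b, X s a b = ∑ j, if a + signed (ε s) j = b then f s j else 0)
    (g : Fin p → G → ℂ) (a b : G) :
    (List.ofFn fun s => X s * Matrix.diagonal (g s)).prod a b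
      = ∑ j : Fin p → G, if a + ∑ s, signed (ε s) (j s) = b then
          (∏ s, f s (j s)) * ∏ s, g s (walk ε a j s.succ) else 0 := by
  induction p generalizing a with
  | zero => simp [Matrix.one_apply]
  | succ p ih =>
    rw [List.ofFn_succ, List.prod_cons, Matrix.mul_apply]
    have ih' := fun a => ih (fun s => ε s.succ) (fun s => f s.succ) (fun s => X s.succ)
      (fun s => hX s.succ) (fun s => g s.succ) a
    rw [← Fintype.sum_equiv (Fin.consEquiv fun _ => G)
      (fun ij => if a + ∑ s, signed (ε s) ((Fin.cons ij.1 ij.2 : Fin (p + 1) → G) s) = b then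
          (∏ s, f s ((Fin.cons ij.1 ij.2 : Fin (p + 1) → G) s)) *
            ∏ s, g s (walk ε a (Fin.cons ij.1 ij.2 : Fin (p + 1) → G) s.succ) else 0) _
      (fun ij => rfl)]
    rw [Fintype.sum_prod_type]
    simp only [walk_cons_succ, Fin.prod_univ_succ, Fin.sum_univ_succ, Fin.cons_zero,
      Fin.cons_succ, walk_zero]
    simp only [Matrix.mul_diagonal, hX 0, Finset.sum_mul]
    rw [Finset.sum_comm]
    refine Finset.sum_congr rfl fun i _ => ?_
    simp only [ite_mul, zero_mul, Finset.sum_ite_eq, Finset.mem_univ, if_true]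
    rw [ih', Finset.mul_sum]
    refine Finset.sum_congr rfl fun j _ => ?_
    rw [← add_assoc]
    split_ifs
    · ring
    · simp

/-- The index `(y + n - x) % n` is subtraction in `Fin n`, and transposing reverses the translation;
this is where a star turns into a backward step. -/
theorem starPow_circ_apply (c : ℕ → ℂ) (n : ℕ) [NeZero n] (t : ℝ) (e : Bool) (a b : Fin n) :
    starPow ((t : ℂ) • circ c n) e a b
      = ∑ j : Fin n, if a + signed e j = b then t * starPow (c j) e else 0 := by
  have key : ∀ x y : Fin n, c (((y : ℕ) + n - (x : ℕ)) % n) = c ((y - x : Fin n) : ℕ) := by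
    intro x y
    rw [Fin.val_sub]
    congr 2
    have := x.isLt
    omega
  cases e
  · have h : ∀ j : Fin n, (a + signed false j = b) ↔ (b - a = j) := by
      intro j
      simp only [signed, Bool.false_eq_true, if_false]
      constructor
      · rintro rfl; abel
      · rintro rfl; abel
    simp [h, starPow, circ, key]
  · have h : ∀ j : Fin n, (a + signed true j = b) ↔ (a - b = j) := by
      intro j
      simp only [signed, if_true]
      constructor
      · rintro rfl; abel
      · rintro rfl; abel
    simp [h, starPow, circ, key, Matrix.star_apply]

theorem starMonomialOne_diagD (θ : ℝ) (n : ℕ) (v : List Bool) :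
    starMonomialOne (diagD θ n) v
      = Matrix.diagonal fun j : Fin n =>
          Complex.exp (Complex.I * θ * ((netExponent v : ℝ) * ((j : ℕ) / n : ℝ) : ℝ)) := by
  have hd : ∀ e : Bool, starPow (diagD θ n) e = Matrix.diagonal fun j : Fin n =>
      Complex.exp (Complex.I * θ * (((if e then -1 else 1 : ℤ) : ℝ) * ((j : ℕ) / n : ℝ) : ℝ)) := by
    intro e
    cases e
    · simp only [starPow, diagD, Bool.false_eq_true, if_false]
      congr 1
      funext j
      rw [← Complex.exp_nat_mul]
      congr 1
      push_cast
      ring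
    · simp only [starPow, diagD, if_true, Matrix.star_eq_conjTranspose,
        Matrix.diagonal_conjTranspose]
      congr 1
      funext j
      simp only [Pi.star_apply, RCLike.star_def]
      rw [← Complex.exp_nat_mul, ← Complex.exp_conj]
      congr 1
      simp
      ring
  induction v with
  | nil => simp [starMonomialOne, netExponent, Matrix.diagonal_one]
  | cons e v ih =>
    rw [starMonomialOne, List.map_cons, List.prod_cons]
    change _ * starMonomialOne (diagD θ n) v = _
    rw [ih, hd, Matrix.diagonal_mul_diagonal]
    congr 1
    funext j
    rw [← Complex.exp_add]
    congr 1
    cases e <;> simp [netExponent] <;> ring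

theorem trace_alternatingMonomial (c : ℕ → ℂ) (θ : ℝ) (n : ℕ) [NeZero n] (t : ℝ) {p : ℕ}
    (ε : Fin p → Bool) (v : Fin (p + 1) → List Bool) :
    (alternatingMonomial ((t : ℂ) • circ c n) (diagD θ n) ε v).trace
      = (t : ℂ) ^ p * ∑ a : Fin n, ∑ j : Fin p → Fin n, if ∑ s, signed (ε s) (j s) = 0 then
          (∏ s, starPow (c (j s)) (ε s)) *
            phase θ (fun r => netExponent (v r)) (fun r => ((walk ε a j r : Fin n) : ℕ) / n)
          else 0 := by
  rw [Matrix.trace, Finset.mul_sum]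
  refine Finset.sum_congr rfl fun a _ => ?_
  rw [alternatingMonomial]
  simp only [starMonomialOne_diagD, Matrix.diag_apply, Matrix.diagonal_mul]
  rw [prod_apply_eq_sum_walks ε (fun s (j : Fin n) => t * starPow (c j) (ε s)) _
    (fun s a b => starPow_circ_apply c n t (ε s) a b), Finset.mul_sum, Finset.mul_sum]
  refine Finset.sum_congr rfl fun j _ => ?_
  simp only [add_eq_left]
  split_ifs
  · rw [phase_eq_prod, Fin.prod_univ_succ, Finset.prod_mul_distrib, walk_zero]
    simp
    ring
  · simp

end PathExpansion

/-! ### Mixed moments of the independent inputs. -/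

section MixedMoments

variable {Ω : Type*} [MeasurableSpace Ω] {μ : Measure Ω}
  {c : ℕ → Ω → ℂ}

theorem measurable_starPow (e : Bool) : Measurable fun z : ℂ => starPow z e := by
  cases e
  · exact measurable_id
  · simpa [starPow] using (continuous_star : Continuous (star : ℂ → ℂ)).measurable

theorem norm_starPow (z : ℂ) (e : Bool) : ‖starPow z e‖ = ‖z‖ := by
  cases e <;> simp [starPow]

/-- The mixed moment `E ∏ s, c_{u s}^{ε s}`. -/
noncomputable def mixedMoment (μ : Measure Ω) (c : ℕ → Ω → ℂ) {p : ℕ} (ε : Fin p → Bool)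
    (u : Fin p → ℕ) : ℂ :=
  ∫ ω, ∏ s, starPow (c (u s) ω) (ε s) ∂μ

/-- Positions are grouped by the variable they carry; distinct variables are independent. -/
theorem mixedMoment_eq_prod (hc : AssumptionI μ c) {p : ℕ} (ε : Fin p → Bool) (u : Fin p → ℕ) :
    mixedMoment μ c ε u
      = ∏ i ∈ Finset.univ.image u, ∫ ω, ∏ s with u s = i, starPow (c i ω) (ε s) ∂μ := by
  classical
  have hind : iIndepFun (fun (i : Finset.univ.image u) => c i) μ :=
    hc.indep.precomp Subtype.val_injective
  have h := hind.integral_fun_prod_comp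
    (f := fun (i : Finset.univ.image u) (z : ℂ) => ∏ s with u s = i, starPow z (ε s))
    (fun i => (hc.measurable i).aemeasurable)
    (fun i => (Finset.measurable_fun_prod _ fun s _ =>
      measurable_starPow (ε s)).aestronglyMeasurable)
  rw [← Finset.prod_coe_sort, ← h, mixedMoment]
  congr 1
  funext ω
  rw [Finset.prod_coe_sort (Finset.univ.image u)
    (fun i => ∏ s with u s = i, starPow (c i ω) (ε s)),
    ← Finset.prod_fiberwise_of_maps_to (g := u) (t := Finset.univ.image u)
      (fun s _ => Finset.mem_image_of_mem u (Finset.mem_univ s))]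
  refine Finset.prod_congr rfl fun i _ => Finset.prod_congr rfl fun s hs => ?_
  rw [(Finset.mem_filter.1 hs).2]

theorem integral_starPow (hc : AssumptionI μ c) (i : ℕ) (e : Bool) :
    ∫ ω, starPow (c i ω) e ∂μ = 0 := by
  cases e
  · simpa [starPow] using hc.mean i
  · simp only [starPow, if_true]
    have := integral_conj (𝕜 := ℂ) (f := c i) (μ := μ)
    rw [hc.mean i] at this
    simpa using this

theorem mixedMoment_eq_zero (hc : AssumptionI μ c) {p : ℕ} (ε : Fin p → Bool) (u : Fin p → ℕ)
    (s : Fin p) (hs : ∀ t, u t = u s → t = s) : mixedMoment μ c ε u = 0 := by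
  classical
  rw [mixedMoment_eq_prod hc]
  refine Finset.prod_eq_zero (Finset.mem_image_of_mem u (Finset.mem_univ s)) ?_
  have : (Finset.univ.filter fun t => u t = u s) = {s} := by
    ext t
    simp only [Finset.mem_filter, Finset.mem_univ, true_and, Finset.mem_singleton]
    exact ⟨hs t, fun h => h ▸ rfl⟩
  simp only [this, Finset.prod_singleton]
  exact integral_starPow hc _ _

/-- Each variable occurs once plain and once conjugated, giving `|c|²`. The moment `E c²` never
enters, so real and complex inputs have the same limit. -/
theorem mixedMoment_eq_one (hc : AssumptionI μ c) {p : ℕ} (ε : Fin p → Bool) (u : Fin p → ℕ)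
    (π : MixedPairPartition ε) (hu : ∀ s t, u t = u s ↔ t = s ∨ t = π.1.1 s) :
    mixedMoment μ c ε u = 1 := by
  classical
  rw [mixedMoment_eq_prod hc]
  refine Finset.prod_eq_one fun i hi => ?_
  obtain ⟨s, -, rfl⟩ := Finset.mem_image.1 hi
  have : (Finset.univ.filter fun t => u t = u s) = {s, π.1.1 s} := by
    ext t
    simp [hu]
  have hne : s ≠ π.1.1 s := (π.1.2 s).2.symm
  simp only [this, Finset.prod_pair hne]
  have h2 : ∀ ω, starPow (c (u s) ω) (ε s) * starPow (c (u s) ω) (ε (π.1.1 s))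
      = ((‖c (u s) ω‖ ^ 2 : ℝ) : ℂ) := by
    intro ω
    have h := π.2 s
    rw [Complex.ofReal_pow, ← Complex.conj_mul']
    revert h
    cases ε (π.1.1 s) <;> cases ε s <;> simp [starPow, mul_comm]
  simp only [h2]
  have h3 : ∫ ω, ((‖c (u s) ω‖ ^ 2 : ℝ) : ℂ) ∂μ = ((∫ ω, ‖c (u s) ω‖ ^ 2 ∂μ : ℝ) : ℂ) :=
    integral_ofReal
  rw [h3, hc.variance, Complex.ofReal_one]

theorem norm_prod_starPow_le {p : ℕ} (ε : Fin p → Bool) (z : Fin p → ℂ) :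
    ‖∏ s, starPow (z s) (ε s)‖ ≤ 1 + ∑ s, ‖z s‖ ^ p := by
  simp only [norm_prod, norm_starPow]
  rcases isEmpty_or_nonempty (Fin p) with h | h
  -- The summand `1` in the bound is needed only here, for the empty product.
  · simp
  · obtain ⟨t, ht⟩ := Finite.exists_max fun s => ‖z s‖
    calc ∏ s, ‖z s‖ ≤ ∏ _s : Fin p, ‖z t‖ :=
          Finset.prod_le_prod (fun _ _ => norm_nonneg _) fun s _ => ht s
      _ = ‖z t‖ ^ p := by simp
      _ ≤ ∑ s, ‖z s‖ ^ p :=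
          Finset.single_le_sum (f := fun s => ‖z s‖ ^ p)
            (fun _ _ => by positivity) (Finset.mem_univ t)
      _ ≤ _ := by linarith

variable [IsProbabilityMeasure μ]

theorem integrable_norm_pow (hc : AssumptionI μ c) (i p : ℕ) :
    Integrable (fun ω => ‖c i ω‖ ^ p) μ := by
  rcases Nat.eq_zero_or_pos p with rfl | hp
  · simp
  · exact (hc.memLp i p).integrable_norm_pow hp.ne'

theorem integrable_prod_starPow (hc : AssumptionI μ c) {p : ℕ} (ε : Fin p → Bool)
    (u : Fin p → ℕ) : Integrable (fun ω => ∏ s, starPow (c (u s) ω) (ε s)) μ := by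
  refine ((integrable_const (1 : ℝ)).add
    (integrable_finsetSum Finset.univ fun s _ => integrable_norm_pow hc (u s) p)).mono' ?_
    (Eventually.of_forall fun ω => norm_prod_starPow_le ε _)
  exact (Finset.measurable_fun_prod _ fun s _ =>
    (measurable_starPow (ε s)).comp (hc.measurable (u s))).aestronglyMeasurable

/-- The uniform bound on absolute moments of order `p` suffices, because a product of `p` factors is
at most the `p`-th power of the largest. -/
theorem exists_norm_mixedMoment_le (hc : AssumptionI μ c) {p : ℕ} (ε : Fin p → Bool) :
    ∃ K : ℝ, 0 ≤ K ∧ ∀ u : Fin p → ℕ, ‖mixedMoment μ c ε u‖ ≤ K := by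
  obtain ⟨B, hB⟩ := hc.bounded p
  have hB0 : 0 ≤ B := (integral_nonneg fun ω => by positivity).trans (hB 0)
  refine ⟨1 + p * B, by positivity, fun u => ?_⟩
  calc ‖mixedMoment μ c ε u‖ ≤ ∫ ω, 1 + ∑ s, ‖c (u s) ω‖ ^ p ∂μ :=
        norm_integral_le_of_norm_le ((integrable_const _).add
          (integrable_finsetSum _ fun s _ => integrable_norm_pow hc _ _))
          (Eventually.of_forall fun ω => norm_prod_starPow_le ε _)
    _ = 1 + ∑ s, ∫ ω, ‖c (u s) ω‖ ^ p ∂μ := by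
        rw [integral_add (integrable_const _)
            (integrable_finsetSum _ fun s _ => integrable_norm_pow hc _ _),
          integral_finsetSum _ fun s _ => integrable_norm_pow hc _ _]
        simp
    _ ≤ 1 + ∑ _s : Fin p, B := by gcongr; exact hB _
    _ = 1 + p * B := by simp

end MixedMoments

/-! ### Counting the negligible step tuples. -/

section Counting

/-- A tuple with at most `k` values factors as a labelling `S → Fin k` followed by a choice of
values; labels that are not used get an arbitrary value. -/
theorem card_filter_card_image_le {S G : Type*} [Fintype S] [DecidableEq S] [Fintype G]
    [DecidableEq G] [Nonempty G] (k : ℕ) :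
    (Finset.univ.filter fun j : S → G => (Finset.univ.image j).card ≤ k).card
      ≤ k ^ Fintype.card S * Fintype.card G ^ k := by
  have hsub : (Finset.univ.filter fun j : S → G => (Finset.univ.image j).card ≤ k)
      ⊆ (Finset.univ : Finset ((S → Fin k) × (Fin k → G))).image fun ry => ry.2 ∘ ry.1 := by
    intro j hj
    have hk : Fintype.card (Finset.univ.image j) ≤ Fintype.card (Fin k) := by
      rw [Fintype.card_coe, Fintype.card_fin]
      exact (Finset.mem_filter.1 hj).2
    obtain ⟨e⟩ := Function.Embedding.nonempty_of_card_le hk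
    let r : S → Fin k := fun s => e ⟨j s, Finset.mem_image_of_mem j (Finset.mem_univ s)⟩
    have hf : j.FactorsThrough r := by
      intro s t hst
      simpa using e.injective hst
    refine Finset.mem_image.2
      ⟨(r, Function.extend r j fun _ => Classical.arbitrary G), Finset.mem_univ _, ?_⟩
    funext s
    exact hf.extend_apply (fun _ => Classical.arbitrary G) s
  calc _ ≤ _ := Finset.card_le_card hsub
    _ ≤ (Finset.univ : Finset ((S → Fin k) × (Fin k → G))).card := Finset.card_image_le
    _ = _ := by simp [Finset.card_univ]

/-- The index tuples with fewer than `p / 2` distinct values. -/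
def fewValues (p : ℕ) (G : Type*) [Fintype G] [DecidableEq G] : Finset (Fin p → G) :=
  Finset.univ.filter fun j => 2 * (Finset.univ.image j).card < p

/-- The closed walks in which some value occurs exactly twice, at positions of the same type. -/
def unmixedAt {p : ℕ} (ε : Fin p → Bool) (G : Type*) [Fintype G] [DecidableEq G]
    [AddCommGroup G] (s t : Fin p) : Finset (Fin p → G) :=
  Finset.univ.filter fun j => 2 * (Finset.univ.image j).card ≤ p ∧
    ∑ s, signed (ε s) (j s) = 0 ∧ s ≠ t ∧ ε s = ε t ∧ j t = j s ∧
      ∀ u, j u = j s → u = s ∨ u = t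

/-- The index tuples that may contribute to the trace without coming from a mixed pair
partition. -/
def negligibleTuples {p : ℕ} (ε : Fin p → Bool) (G : Type*) [Fintype G] [DecidableEq G]
    [AddCommGroup G] : Finset (Fin p → G) :=
  fewValues p G ∪ Finset.univ.biUnion fun st : Fin p × Fin p => unmixedAt ε G st.1 st.2

/-- Doubling modulo `n` is injective on each half of `Fin n`, since `2x` needs no reduction in the
lower half and exactly one subtraction of `n` in the upper. -/
theorem Fin.eq_of_add_self_eq {n : ℕ} {x y : Fin n} (h : x + x = y + y)
    (hxy : 2 * (x : ℕ) < n ↔ 2 * (y : ℕ) < n) : x = y := by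
  have h' := congrArg Fin.val h
  rw [Fin.val_add, Fin.val_add] at h'
  have hx := x.isLt
  have hy := y.isLt
  apply Fin.ext
  by_cases hc : 2 * (x : ℕ) < n
  · have hd := hxy.1 hc
    rw [Nat.mod_eq_of_lt (by omega), Nat.mod_eq_of_lt (by omega)] at h'
    omega
  · have hd : ¬ 2 * (y : ℕ) < n := fun hd => hc (hxy.2 hd)
    rw [Nat.mod_eq_sub_mod (by omega), Nat.mod_eq_sub_mod (a := (y : ℕ) + y) (by omega),
      Nat.mod_eq_of_lt (by omega), Nat.mod_eq_of_lt (by omega)] at h'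
    omega

/-- Deleting the positions `s` and `t` removes one value, leaving at most `p / 2 - 1`. The deleted
step is recovered up to two choices: both occurrences have the same sign, so closing the walk fixes
its double. -/
theorem card_unmixedAt_le {p : ℕ} (ε : Fin p → Bool) (n : ℕ) [NeZero n] (s t : Fin p) :
    (unmixedAt ε (Fin n) s t).card ≤ 2 * ((p + 1) ^ p * n ^ (p / 2 - 1)) := by
  classical
  by_cases hst : s ≠ t ∧ ε s = ε t
  swap
  · have : unmixedAt ε (Fin n) s t = ∅ := by
      refine Finset.filter_eq_empty_iff.2 fun j _ h => hst ⟨h.2.2.1, h.2.2.2.1⟩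
    simp [this]
  let S := {u : Fin p // u ≠ s ∧ u ≠ t}
  let ρ : (Fin p → Fin n) → (S → Fin n) := fun j u => j u.1
  have hcard := card_filter_card_image_le (S := S) (G := Fin n) (p / 2 - 1)
  have hS : Fintype.card S ≤ p := (Fintype.card_subtype_le _).trans (by simp)
  refine (Finset.card_le_mul_card_image_of_maps_to (f := ρ)
    (t := Finset.univ.filter fun j : S → Fin n => (Finset.univ.image j).card ≤ p / 2 - 1)
    ?_ 2 ?_).trans ?_
  · intro j hj
    obtain ⟨h1, -, -, -, -, h2⟩ := (Finset.mem_filter.1 hj).2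
    refine Finset.mem_filter.2 ⟨Finset.mem_univ _, ?_⟩
    have hsub : Finset.univ.image (ρ j) ⊆ (Finset.univ.image j).erase (j s) := by
      intro x hx
      obtain ⟨u, -, rfl⟩ := Finset.mem_image.1 hx
      refine Finset.mem_erase.2 ⟨fun h => ?_, Finset.mem_image_of_mem j (Finset.mem_univ _)⟩
      rcases h2 u.1 h with h | h
      · exact u.2.1 h
      · exact u.2.2 h
    have h3 := Finset.card_le_card hsub
    rw [Finset.card_erase_of_mem (Finset.mem_image_of_mem j (Finset.mem_univ _))] at h3
    omega
  · intro j' _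
    -- The half of `Fin n` containing `j s` separates the two solutions of the doubling equation.
    refine (Finset.card_le_card_of_injOn (t := (Finset.univ : Finset Bool))
      (fun j => decide (2 * (j s : ℕ) < n)) (fun _ _ => Finset.mem_univ _) ?_).trans (by simp)
    intro x hx y hy hxy
    obtain ⟨hx1, hx2⟩ := Finset.mem_filter.1 hx
    obtain ⟨hy1, hy2⟩ := Finset.mem_filter.1 hy
    obtain ⟨-, sx, -, -, tx, -⟩ := (Finset.mem_filter.1 hx1).2
    obtain ⟨-, sy, -, -, ty, -⟩ := (Finset.mem_filter.1 hy1).2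
    have hrest : ∀ u, u ≠ s → u ≠ t → x u = y u := fun u h1 h2 =>
      congrFun (hx2.trans hy2.symm) ⟨u, h1, h2⟩
    have hsum : ∀ z : Fin p → Fin n, z t = z s → ∑ s, signed (ε s) (z s)
        = signed (ε s) (z s) + signed (ε s) (z s)
          + ∑ u ∈ (Finset.univ.erase s).erase t, signed (ε u) (z u) := by
      intro z hz
      rw [← Finset.add_sum_erase _ _ (Finset.mem_univ s),
        ← Finset.add_sum_erase _ _ (Finset.mem_erase.2 ⟨hst.1.symm, Finset.mem_univ t⟩),
        ← hst.2, hz, add_assoc]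
    have hrest' : ∑ u ∈ (Finset.univ.erase s).erase t, signed (ε u) (x u)
        = ∑ u ∈ (Finset.univ.erase s).erase t, signed (ε u) (y u) := by
      refine Finset.sum_congr rfl fun u hu => ?_
      rw [Finset.mem_erase, Finset.mem_erase] at hu
      rw [hrest u hu.2.1 hu.1]
    rw [hsum x tx, hrest'] at sx
    rw [hsum y ty] at sy
    have hdbl : signed (ε s) (x s) + signed (ε s) (x s)
        = signed (ε s) (y s) + signed (ε s) (y s) := add_right_cancel (sx.trans sy.symm)
    have hdbl' : x s + x s = y s + y s := by
      revert hdbl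
      cases ε s
      · exact id
      · simp only [signed, if_true]
        intro h
        rw [← neg_add, ← neg_add] at h
        exact neg_injective h
    have hs : x s = y s := Fin.eq_of_add_self_eq hdbl' (by simpa using hxy)
    funext u
    by_cases h1 : u = s
    · rw [h1, hs]
    by_cases h2 : u = t
    · rw [h2, tx, ty, hs]
    exact hrest u h1 h2
  · refine Nat.mul_le_mul_left 2 (hcard.trans ?_)
    rw [Fintype.card_fin]
    refine Nat.mul_le_mul_right _ ?_
    exact (Nat.pow_le_pow_left (by omega) _).trans (Nat.pow_le_pow_right (by omega) hS)

theorem pow_mul_sqrt_le {n : ℕ} (hn : 1 ≤ n) {k p : ℕ} (h : 2 * k + 1 ≤ p) :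
    (n : ℝ) ^ k * √n ≤ √n ^ p := by
  have h1 : (1 : ℝ) ≤ √n := Real.one_le_sqrt.2 (by exact_mod_cast hn)
  calc (n : ℝ) ^ k * √n = √n ^ (2 * k + 1) := by
        rw [pow_succ, pow_mul, Real.sq_sqrt (Nat.cast_nonneg n)]
    _ ≤ √n ^ p := pow_le_pow_right₀ h1 h

/-- The factor `√n` on the left expresses a bound of order `n^{(p-1)/2}` without half-integer
exponents. -/
theorem card_negligibleTuples_le {p : ℕ} (ε : Fin p → Bool) :
    ∃ K : ℝ, 0 ≤ K ∧ ∀ (n : ℕ) [NeZero n],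
      ((negligibleTuples ε (Fin n)).card : ℝ) * √n ≤ K * √n ^ p := by
  refine ⟨(p + 1) ^ p + (p * p) * (2 * (p + 1) ^ p), by positivity, fun n _ => ?_⟩
  have hn : 1 ≤ n := Nat.one_le_iff_ne_zero.2 (NeZero.ne n)
  rcases Nat.eq_zero_or_pos p with rfl | hp
  · have : negligibleTuples ε (Fin n) = ∅ := by
      simp [negligibleTuples, fewValues]
    simp [this]
  have h1 : ((fewValues p (Fin n)).card : ℝ) * √n ≤ (p + 1) ^ p * √n ^ p := by
    have h := card_filter_card_image_le (S := Fin p) (G := Fin n) ((p - 1) / 2)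
    have hsub : fewValues p (Fin n) ⊆ Finset.univ.filter fun j : Fin p → Fin n =>
        (Finset.univ.image j).card ≤ (p - 1) / 2 := by
      refine Finset.monotone_filter_right _ fun j _ hj => ?_
      omega
    have h2 : (fewValues p (Fin n)).card ≤ (p + 1) ^ p * n ^ ((p - 1) / 2) := by
      refine (Finset.card_le_card hsub).trans (h.trans ?_)
      rw [Fintype.card_fin, Fintype.card_fin]
      exact Nat.mul_le_mul_right _ (Nat.pow_le_pow_left (by omega) _)
    calc ((fewValues p (Fin n)).card : ℝ) * √n
        ≤ ((p + 1) ^ p * n ^ ((p - 1) / 2)) * √n := by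
          gcongr
          exact_mod_cast h2
      _ = (p + 1) ^ p * (n ^ ((p - 1) / 2) * √n) := by ring
      _ ≤ _ := by
          gcongr
          exact pow_mul_sqrt_le hn (by omega)
  have h2 : ∀ s t, ((unmixedAt ε (Fin n) s t).card : ℝ) * √n ≤ 2 * (p + 1) ^ p * √n ^ p := by
    intro s t
    rcases Nat.lt_or_ge p 2 with hp2 | hp2
    · have : unmixedAt ε (Fin n) s t = ∅ :=
        Finset.filter_eq_empty_iff.2 fun j _ h => h.2.2.1 (Fin.ext (by omega))
      rw [this]
      simp
      positivity
    calc ((unmixedAt ε (Fin n) s t).card : ℝ) * √n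
        ≤ (2 * ((p + 1) ^ p * n ^ (p / 2 - 1))) * √n := by
          gcongr
          exact_mod_cast card_unmixedAt_le ε n s t
      _ = 2 * (p + 1) ^ p * (n ^ (p / 2 - 1) * √n) := by ring
      _ ≤ _ := by
          gcongr
          exact pow_mul_sqrt_le hn (by omega)
  have h3 : ((negligibleTuples ε (Fin n)).card : ℝ) ≤ (fewValues p (Fin n)).card
      + ∑ st : Fin p × Fin p, ((unmixedAt ε (Fin n) st.1 st.2).card : ℝ) := by
    have := (Finset.card_union_le (fewValues p (Fin n)) _).trans
      (Nat.add_le_add_left (Finset.card_biUnion_le (s := (Finset.univ : Finset (Fin p × Fin p)))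
        (t := fun st => unmixedAt ε (Fin n) st.1 st.2)) _)
    exact_mod_cast this
  calc ((negligibleTuples ε (Fin n)).card : ℝ) * √n
      ≤ ((fewValues p (Fin n)).card
          + ∑ st : Fin p × Fin p, ((unmixedAt ε (Fin n) st.1 st.2).card : ℝ)) * √n := by
        gcongr
    _ = (fewValues p (Fin n)).card * √n
          + ∑ st : Fin p × Fin p, ((unmixedAt ε (Fin n) st.1 st.2).card : ℝ) * √n := by
        rw [add_mul, Finset.sum_mul]
    _ ≤ (p + 1) ^ p * √n ^ p + ∑ _st : Fin p × Fin p, 2 * (p + 1) ^ p * √n ^ p :=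
        add_le_add h1 (Finset.sum_le_sum fun st _ => h2 st.1 st.2)
    _ = _ := by
        simp
        ring

/-! ### Comparison of the weights with mixed pair partitions. -/

/-- A tuple with no isolated value and at least half as many values as entries takes each of its
values at the two elements of a block of a pair partition. -/
theorem exists_pairPartition {p : ℕ} {G : Type*} [DecidableEq G] (j : Fin p → G)
    (hj : ∀ s, ∃ t, t ≠ s ∧ j t = j s) (hp : p ≤ 2 * (Finset.univ.image j).card) :
    ∃ π : PairPartition p, ∀ s t, j t = j s ↔ t = s ∨ t = π.1 s := by
  classical
  have h2 : ∀ i ∈ Finset.univ.image j, 2 ≤ (Finset.univ.filter fun s => j s = i).card := by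
    intro i hi
    obtain ⟨s, -, rfl⟩ := Finset.mem_image.1 hi
    obtain ⟨t, ht, hts⟩ := hj s
    refine Finset.one_lt_card.2 ⟨t, by simp [hts], s, by simp, ht⟩
  have hsum : p = ∑ i ∈ Finset.univ.image j, (Finset.univ.filter fun s => j s = i).card := by
    have := Finset.card_eq_sum_card_fiberwise (f := j) (s := Finset.univ)
      (t := Finset.univ.image j) (fun s _ => Finset.mem_image_of_mem j (Finset.mem_univ s))
    simpa using this
  -- All fibres have at least two elements and their sizes add up to at most twice their number, so
  -- each has exactly two.
  have heq : ∀ i ∈ Finset.univ.image j, 2 = (Finset.univ.filter fun s => j s = i).card := by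
    refine (Finset.sum_eq_sum_iff_of_le h2).1 (le_antisymm (Finset.sum_le_sum h2) ?_)
    rw [← hsum]
    simpa [mul_comm] using hp
  choose π hπ using hj
  have hfib : ∀ s t, j t = j s ↔ t = s ∨ t = π s := by
    intro s t
    have h : ({s, π s} : Finset (Fin p)) = Finset.univ.filter fun t => j t = j s := by
      refine Finset.eq_of_subset_of_card_le ?_ ?_
      · intro u hu
        rcases Finset.mem_insert.1 hu with rfl | hu
        · simp
        · rw [Finset.mem_singleton.1 hu]
          simp [(hπ s).2]
      · rw [← heq _ (Finset.mem_image_of_mem j (Finset.mem_univ s)),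
          Finset.card_pair (hπ s).1.symm]
    have := Finset.ext_iff.1 h t
    simpa using this.symm
  have hinv : Function.Involutive π := by
    intro s
    have h := (hfib s (π (π s))).1 (((hπ (π s)).2).trans (hπ s).2)
    exact h.resolve_right (hπ (π s)).1
  exact ⟨⟨hinv.toPerm, fun s => ⟨hinv s, (hπ s).1⟩⟩, hfib⟩

/-- The two steps of a mixed block cancel, so the closing condition imposes nothing on such tuples
and no factor `n` is lost. -/
theorem sum_signed_eq_zero {p : ℕ} {ε : Fin p → Bool} {G : Type*} [AddCommGroup G]
    (π : MixedPairPartition ε) (j : Fin p → G) (hj : ∀ s, j (π.1.1 s) = j s) :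
    ∑ s, signed (ε s) (j s) = 0 := by
  refine Finset.sum_involution (fun s _ => π.1.1 s) ?_ (fun s _ _ => (π.1.2 s).2)
    (fun _ _ => Finset.mem_univ _) (fun s _ => (π.1.2 s).1)
  intro s _
  have h := π.2 s
  rw [hj]
  revert h
  cases ε (π.1.1 s) <;> cases ε s <;> simp [signed]

/-- The contribution of the index tuple `j` to the normalized trace, compared with the number of
mixed pair partitions along which `j` is constant. -/
noncomputable def excess {Ω : Type*} [MeasurableSpace Ω] (μ : Measure Ω) (c : ℕ → Ω → ℂ)
    {p : ℕ} (ε : Fin p → Bool) {n : ℕ} [NeZero n] (j : Fin p → Fin n) : ℂ :=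
  (if ∑ s, signed (ε s) (j s) = 0 then mixedMoment μ c ε (fun s => (j s : ℕ)) else 0)
    - ∑ π : MixedPairPartition ε, if ∀ s, j (π.1.1 s) = j s then 1 else 0

variable {Ω : Type*} [MeasurableSpace Ω] {μ : Measure Ω} {c : ℕ → Ω → ℂ}

/-- An isolated value makes the moment vanish and is incompatible with every pairing. Otherwise each
value occurs exactly twice and determines a unique pairing: if it is mixed, both terms equal one; if
not, both vanish, as a closed walk would be in `unmixedAt`. -/
theorem excess_eq_zero (hc : AssumptionI μ c) {p : ℕ} (ε : Fin p → Bool) {n : ℕ} [NeZero n]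
    (j : Fin p → Fin n) (hj : j ∉ negligibleTuples ε (Fin n)) : excess μ c ε j = 0 := by
  rw [negligibleTuples, Finset.mem_union, not_or] at hj
  obtain ⟨hj1, hj2⟩ := hj
  by_cases hs : ∀ s, ∃ t, t ≠ s ∧ j t = j s
  · have hcard : p ≤ 2 * (Finset.univ.image j).card := by
      simpa [fewValues] using hj1
    obtain ⟨π₀, hπ₀⟩ := exists_pairPartition j hs hcard
    have huniq : ∀ π : MixedPairPartition ε, (∀ s, j (π.1.1 s) = j s) → π.1 = π₀ := by
      intro π hπ
      refine Subtype.ext (Equiv.ext fun s => ?_)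
      exact ((hπ₀ s _).1 (hπ s)).resolve_left (π.1.2 s).2
    by_cases hmix : ∀ s, ε (π₀.1 s) ≠ ε s
    · let π : MixedPairPartition ε := ⟨π₀, hmix⟩
      have hπ : ∀ s, j (π.1.1 s) = j s := fun s => (hπ₀ s _).2 (Or.inr rfl)
      have hM : mixedMoment μ c ε (fun s => (j s : ℕ)) = 1 :=
        mixedMoment_eq_one hc ε _ π fun s t => by rw [← hπ₀ s t]; exact Fin.val_inj
      rw [excess, if_pos (sum_signed_eq_zero π j hπ), hM, Finset.sum_eq_single π]
      · rw [if_pos hπ, sub_self]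
      · intro π' _ hne
        exact if_neg fun h => hne (Subtype.ext (huniq π' h))
      · exact fun h => absurd (Finset.mem_univ _) h
    · rw [excess, if_neg, Finset.sum_eq_zero, sub_zero]
      · intro π _
        refine if_neg fun h => hmix ?_
        rw [← huniq π h]
        exact π.2
      · intro hsum
        push Not at hmix
        obtain ⟨s, hs'⟩ := hmix
        refine hj2 (Finset.mem_biUnion.2 ⟨(s, π₀.1 s), Finset.mem_univ _,
          Finset.mem_filter.2 ⟨Finset.mem_univ _, ?_, hsum, (π₀.2 s).2.symm, hs'.symm,
            (hπ₀ s _).2 (Or.inr rfl), fun u hu => (hπ₀ s u).1 hu⟩⟩)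
        calc 2 * (Finset.univ.image j).card
            ≤ ∑ i ∈ Finset.univ.image j, (Finset.univ.filter fun s => j s = i).card := by
              rw [mul_comm, ← smul_eq_mul]
              refine Finset.card_nsmul_le_sum _ _ _ fun i hi => ?_
              obtain ⟨s, -, rfl⟩ := Finset.mem_image.1 hi
              obtain ⟨t, ht, hts⟩ := hs s
              exact Finset.one_lt_card.2 ⟨t, by simp [hts], s, by simp, ht⟩
          _ = p := by
              rw [← Finset.card_eq_sum_card_fiberwise (f := j) (s := Finset.univ)
                (fun s _ => Finset.mem_image_of_mem j (Finset.mem_univ s))]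
              simp
  · push Not at hs
    obtain ⟨s, hs⟩ := hs
    have hM : mixedMoment μ c ε (fun s => (j s : ℕ)) = 0 :=
      mixedMoment_eq_zero hc ε _ s fun t ht => by
        by_contra hne
        exact hs t hne (Fin.val_inj.1 ht)
    rw [excess, hM, ite_self, Finset.sum_eq_zero, sub_zero]
    intro π _
    exact if_neg fun h => hs _ (π.1.2 s).2 (h s)

theorem exists_norm_excess_le [IsProbabilityMeasure μ] (hc : AssumptionI μ c) {p : ℕ}
    (ε : Fin p → Bool) :
    ∃ K : ℝ, 0 ≤ K ∧ ∀ (n : ℕ) [NeZero n] (j : Fin p → Fin n), ‖excess μ c ε j‖ ≤ K := by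
  obtain ⟨K, hK0, hK⟩ := exists_norm_mixedMoment_le hc ε
  refine ⟨K + Fintype.card (MixedPairPartition ε), by positivity, fun n _ j => ?_⟩
  refine (norm_sub_le _ _).trans (add_le_add ?_ ?_)
  · split_ifs
    · exact hK _
    · simpa using hK0
  · refine (norm_sum_le _ _).trans ?_
    calc _ ≤ ∑ _π : MixedPairPartition ε, (1 : ℝ) := by
          refine Finset.sum_le_sum fun π _ => ?_
          split_ifs <;> simp
      _ = _ := by simp

/-- The contributions of all index tuples that do not come from mixed pair partitions are
negligible. -/
theorem exists_norm_sum_excess_le [IsProbabilityMeasure μ] (hc : AssumptionI μ c) {p : ℕ}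
    (ε : Fin p → Bool) :
    ∃ K : ℝ, 0 ≤ K ∧ ∀ (n : ℕ) [NeZero n] (F : Fin n → (Fin p → Fin n) → ℂ),
      (∀ a j, ‖F a j‖ ≤ 1) →
        ‖∑ a : Fin n, ∑ j : Fin p → Fin n, excess μ c ε j * F a j‖ * √n ≤ K * (n * √n ^ p) := by
  obtain ⟨K, hK0, hK⟩ := exists_norm_excess_le hc ε
  obtain ⟨L, hL0, hL⟩ := card_negligibleTuples_le ε
  refine ⟨K * L, by positivity, fun n _ F hF => ?_⟩
  have h1 : ∀ a, ‖∑ j : Fin p → Fin n, excess μ c ε j * F a j‖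
      ≤ (negligibleTuples ε (Fin n)).card * K := by
    intro a
    rw [← Finset.sum_subset (Finset.subset_univ (negligibleTuples ε (Fin n)))
      fun j _ hj => by rw [excess_eq_zero hc ε j hj, zero_mul], ← nsmul_eq_mul]
    refine norm_sum_le_of_le _ (f := fun _ => _) (n := fun _ => K) (fun j _ => ?_) |>.trans ?_
    · rw [norm_mul]
      exact (mul_le_of_le_one_right (norm_nonneg _) (hF a j)).trans (hK n j)
    · rw [Finset.sum_const]
  calc _ ≤ (∑ _a : Fin n, (negligibleTuples ε (Fin n)).card * K) * √n := by
        gcongr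
        exact norm_sum_le_of_le _ fun a _ => h1 a
    _ = K * n * ((negligibleTuples ε (Fin n)).card * √n) := by
        simp
        ring
    _ ≤ K * n * (L * √n ^ p) := by
        exact mul_le_mul_of_nonneg_left (hL n) (by positivity)
    _ = _ := by ring

end Counting

/-! ### Riemann sums on the unit cube. -/

section RiemannSums

variable {ι : Type*}

/-- The half-open box of side `1 / n` with corner `k / n`. -/
def gridBox (n : ℕ) (k : ι → Fin n) : Set (ι → ℝ) :=
  Set.univ.pi fun i => Set.Ico ((k i : ℕ) / n : ℝ) (((k i : ℕ) + 1) / n)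

theorem floor_of_mem_gridBox {n : ℕ} [NeZero n] {k : ι → Fin n} {x : ι → ℝ}
    (hx : x ∈ gridBox n k) (i : ι) : ⌊x i * n⌋₊ = (k i : ℕ) := by
  have hn : (0 : ℝ) < n := by exact_mod_cast Nat.pos_of_ne_zero (NeZero.ne n)
  obtain ⟨h1, h2⟩ := hx i (Set.mem_univ i)
  rw [div_le_iff₀ hn] at h1
  rw [lt_div_iff₀ hn] at h2
  exact (Nat.floor_eq_iff ((Nat.cast_nonneg _).trans h1)).2 ⟨h1, h2⟩

theorem iUnion_gridBox (n : ℕ) [NeZero n] :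
    ⋃ k : ι → Fin n, gridBox n k = Set.univ.pi fun _ => Set.Ico (0 : ℝ) 1 := by
  have hn : (0 : ℝ) < n := by exact_mod_cast Nat.pos_of_ne_zero (NeZero.ne n)
  ext x
  simp only [Set.mem_iUnion]
  constructor
  · rintro ⟨k, hk⟩ i -
    obtain ⟨h1, h2⟩ := hk i (Set.mem_univ i)
    refine ⟨le_trans (by positivity) h1, h2.trans_le ?_⟩
    rw [div_le_one hn]
    exact_mod_cast (k i).isLt
  · intro hx
    have hlt : ∀ i, ⌊x i * n⌋₊ < n := fun i => by
      rw [Nat.floor_lt (mul_nonneg (hx i (Set.mem_univ i)).1 hn.le)]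
      exact mul_lt_of_lt_one_left hn (hx i (Set.mem_univ i)).2
    refine ⟨fun i => ⟨⌊x i * n⌋₊, hlt i⟩, fun i _ => ⟨?_, ?_⟩⟩
    · rw [div_le_iff₀ hn]
      exact Nat.floor_le (mul_nonneg (hx i (Set.mem_univ i)).1 hn.le)
    · rw [lt_div_iff₀ hn]
      exact Nat.lt_floor_add_one _

variable [Fintype ι] [DecidableEq ι]

/-- The rounded function is constant on grid boxes, which tile the half-open cube; the remaining
faces are null. A Riemann sum is thus exactly an integral. -/
theorem setIntegral_comp_floor (n : ℕ) [NeZero n] (F : (ι → ℝ) → ℂ) :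
    ∫ x in Set.Icc (0 : ι → ℝ) 1, F (fun i => (⌊x i * n⌋₊ : ℝ) / n)
      = ((n : ℂ) ^ Fintype.card ι)⁻¹ * ∑ k : ι → Fin n, F fun i => ((k i : ℕ) : ℝ) / n := by
  have hae : (Set.univ.pi fun _ : ι => Set.Ico (0 : ℝ) 1) =ᵐ[volume] Set.Icc (0 : ι → ℝ) 1 :=
    Measure.univ_pi_Ico_ae_eq_Icc
  have hmeas : ∀ k : ι → Fin n, MeasurableSet (gridBox n k) := fun k =>
    MeasurableSet.univ_pi fun _ => measurableSet_Ico
  have hconst : ∀ k : ι → Fin n, Set.EqOn (fun x : ι → ℝ => F fun i => (⌊x i * n⌋₊ : ℝ) / n)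
      (fun _ => F fun i => ((k i : ℕ) : ℝ) / n) (gridBox n k) := by
    intro k x hx
    simp only [floor_of_mem_gridBox hx]
  have hvol : ∀ k : ι → Fin n,
      volume (gridBox n k) = ENNReal.ofReal ((n : ℝ)⁻¹ ^ Fintype.card ι) := by
    intro k
    rw [gridBox, Real.volume_pi_Ico]
    have : ∀ i, ((k i : ℕ) + 1 : ℝ) / n - (k i : ℕ) / n = (n : ℝ)⁻¹ := fun i => by ring
    simp only [this]
    rw [Finset.prod_const, Finset.card_univ, ENNReal.ofReal_pow (by positivity)]
  rw [← setIntegral_congr_set hae, ← iUnion_gridBox n, integral_iUnion_fintype hmeas]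
  · rw [Finset.mul_sum]
    refine Finset.sum_congr rfl fun k _ => ?_
    rw [setIntegral_congr_fun (hmeas k) (hconst k), setIntegral_const, measureReal_def, hvol,
      ENNReal.toReal_ofReal (by positivity), Complex.real_smul]
    push_cast
    rw [inv_pow]
  · intro k l hkl
    refine Set.disjoint_left.2 fun x hx hx' => hkl (funext fun i => Fin.ext ?_)
    rw [← floor_of_mem_gridBox hx, floor_of_mem_gridBox hx']
  · intro k
    refine IntegrableOn.congr_fun ?_ (hconst k).symm (hmeas k)
    exact integrableOn_const (by rw [hvol]; exact ENNReal.ofReal_ne_top)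

/-- Riemann sums over the grid of mesh `1 / n` converge for bounded functions that are continuous
almost everywhere on the unit cube. -/
theorem tendsto_riemannSum (F : (ι → ℝ) → ℂ) (hF : Measurable F) (C : ℝ) (hC : ∀ x, ‖F x‖ ≤ C)
    (hcont : ∀ᵐ x, ContinuousAt F x) :
    Tendsto (fun n : ℕ => (((n + 1 : ℕ) : ℂ) ^ Fintype.card ι)⁻¹ *
        ∑ k : ι → Fin (n + 1), F fun i => ((k i : ℕ) : ℝ) / (n + 1 : ℕ)) atTop
      (𝓝 (∫ x in Set.Icc (0 : ι → ℝ) 1, F x)) := by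
  -- The rounded point tends to `x`, so dominated convergence applies at continuity points of `F`.
  simp only [← setIntegral_comp_floor]
  refine tendsto_integral_of_dominated_convergence (fun _ => C) (fun n => ?_) ?_ (fun n => ?_) ?_
  · refine (hF.comp ?_).aestronglyMeasurable
    refine measurable_pi_lambda _ fun i => ?_
    exact ((measurable_from_nat (f := fun m : ℕ => (m : ℝ))).comp
      (((measurable_pi_apply i).mul_const _).nat_floor)).div_const _
  · exact integrableOn_const (by simp [Real.volume_Icc_pi])
  · exact Eventually.of_forall fun x => hC _
  · filter_upwards [ae_restrict_of_ae hcont, ae_restrict_mem measurableSet_Icc] with x hx hx01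
    refine hx.tendsto.comp (tendsto_pi_nhds.2 fun i => ?_)
    exact (tendsto_nat_floor_mul_div_atTop (hx01.1 i)).comp
      (tendsto_natCast_atTop_atTop.comp (tendsto_add_atTop_nat 1))

end RiemannSums

/-! ### Pairing integrals as limits of sums over block variables. -/

section PairingIntegral

variable {p : ℕ} {ε : Fin p → Bool}

/-- The coordinate of the block of `s` in a family indexed by the base point and the blocks. -/
def blockValue {G : Type*} (π : MixedPairPartition ε) (x : FreeIndex ε → G) (s : Fin p) : G :=
  if h : ε s = false then x (some ⟨s, h⟩)
  else x (some ⟨π.1.1 s, by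
    have h1 := π.2 s
    revert h1 h
    cases ε (π.1.1 s) <;> cases ε s <;> simp⟩)

theorem increment_eq_signed (π : MixedPairPartition ε) (x : FreeIndex ε → ℝ) (s : Fin p) :
    increment π x s = signed (ε s) (blockValue π x s) := by
  by_cases h : ε s = false
  · rw [increment, blockValue, dif_pos h, dif_pos h, signed, if_neg (by simp [h])]
  · rw [increment, blockValue, dif_neg h, dif_neg h, signed, if_pos (by simpa using h)]

theorem linearForm_eq_walk (π : MixedPairPartition ε) (x : FreeIndex ε → ℝ) (r : Fin (p + 1)) :
    linearForm π x r = walk ε (x none) (blockValue π x) r := by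
  rw [linearForm, walk]
  congr 1
  refine Finset.sum_congr rfl fun s _ => ?_
  rw [increment_eq_signed]

/-- The coordinate `i` does not depend on `x`, which makes the block value a projection. That it
differs from `none` keeps the coefficient of the base point equal to one. -/
theorem exists_blockValue_eq_apply {G : Type*} (π : MixedPairPartition ε) (s : Fin p) :
    ∃ i : FreeIndex ε, i ≠ none ∧ ∀ x : FreeIndex ε → G, blockValue π x s = x i := by
  unfold blockValue
  split_ifs with h
  · exact ⟨_, Option.some_ne_none _, fun x => rfl⟩
  · exact ⟨_, Option.some_ne_none _, fun x => rfl⟩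

theorem signed_eq_zsmul {G : Type*} [AddGroup G] (e : Bool) (j : G) :
    signed e j = (if e then -1 else 1 : ℤ) • j := by
  cases e <;> simp [signed]

/-- `linearForm` as a linear map. -/
noncomputable def linearFormMap (π : MixedPairPartition ε) (r : Fin (p + 1)) :
    (FreeIndex ε → ℝ) →ₗ[ℝ] ℝ :=
  LinearMap.proj none + ∑ s : Fin p, if (s : ℕ) < (r : ℕ) then
    (if ε s then -1 else 1 : ℤ) •
      LinearMap.proj (exists_blockValue_eq_apply (G := ℝ) π s).choose else 0

theorem linearFormMap_apply (π : MixedPairPartition ε) (r : Fin (p + 1)) (x : FreeIndex ε → ℝ) :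
    linearFormMap π r x = linearForm π x r := by
  rw [linearForm_eq_walk, linearFormMap, walk]
  rw [LinearMap.add_apply, LinearMap.sum_apply, LinearMap.proj_apply]
  congr 1
  refine Finset.sum_congr rfl fun s _ => ?_
  rw [(exists_blockValue_eq_apply π s).choose_spec.2, signed_eq_zsmul]
  split_ifs <;> simp

theorem linearFormMap_surjective (π : MixedPairPartition ε) (r : Fin (p + 1)) :
    Function.Surjective (linearFormMap π r) := by
  classical
  intro y
  refine ⟨Pi.single none y, ?_⟩
  rw [linearFormMap_apply, linearForm_eq_walk, walk, Finset.sum_eq_zero, add_zero,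
    Pi.single_eq_same]
  intro s _
  obtain ⟨i, hi, h⟩ := exists_blockValue_eq_apply (G := ℝ) π s
  rw [h, Pi.single_eq_of_ne hi, signed_eq_zsmul, smul_zero, ite_self]

theorem continuous_linearForm (π : MixedPairPartition ε) (r : Fin (p + 1)) :
    Continuous fun x => linearForm π x r := by
  simp only [← linearFormMap_apply]
  exact (linearFormMap π r).continuous_of_finiteDimensional

/-- The integers are where the fractional part jumps. A surjective linear form pulls null sets back
to null sets, and surjectivity comes from the base point. -/
theorem ae_linearForm_ne_int (π : MixedPairPartition ε) (r : Fin (p + 1)) :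
    ∀ᵐ x : FreeIndex ε → ℝ, linearForm π x r ∉ Set.range ((↑) : ℤ → ℝ) := by
  have hc : (Set.range ((↑) : ℤ → ℝ)).Countable := Set.countable_range _
  have h := (ae_comp_linearMap_mem_iff (linearFormMap π r) volume volume
    (linearFormMap_surjective π r) hc.measurableSet.compl).2 (hc.ae_notMem volume)
  filter_upwards [h] with x hx
  rwa [← linearFormMap_apply]

theorem continuous_phase (θ : ℝ) {q : ℕ} (k : Fin q → ℤ) : Continuous (phase θ k) := by
  unfold phase
  fun_prop

theorem measurable_phase_fract (θ : ℝ) (π : MixedPairPartition ε) (k : Fin (p + 1) → ℤ) :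
    Measurable fun x => phase θ k fun r => Int.fract (linearForm π x r) :=
  (continuous_phase θ k).measurable.comp
    (measurable_pi_lambda _ fun r => (continuous_linearForm π r).measurable.fract)

theorem ae_continuousAt_phase_fract (θ : ℝ) (π : MixedPairPartition ε) (k : Fin (p + 1) → ℤ) :
    ∀ᵐ x, ContinuousAt (fun x => phase θ k fun r => Int.fract (linearForm π x r)) x := by
  filter_upwards [ae_all_iff.2 fun r => ae_linearForm_ne_int π r] with x hx
  refine (continuous_phase θ k).continuousAt.comp
    (continuousAt_pi.2 fun r => ContinuousAt.comp (g := Int.fract) ?_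
      (continuous_linearForm π r).continuousAt)
  exact continuousAt_fract fun h => hx r ⟨_, h.symm⟩

theorem tendsto_pairingIntegral (θ : ℝ) (π : MixedPairPartition ε) (k : Fin (p + 1) → ℤ) :
    Tendsto (fun n : ℕ => (((n + 1 : ℕ) : ℂ) ^ Fintype.card (FreeIndex ε))⁻¹ *
        ∑ x : FreeIndex ε → Fin (n + 1), phase θ k fun r =>
          Int.fract (linearForm π (fun i => ((x i : ℕ) : ℝ) / (n + 1 : ℕ)) r)) atTop
      (𝓝 (pairingIntegral θ π k)) :=
  tendsto_riemannSum (fun x => phase θ k fun r => Int.fract (linearForm π x r))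
    (measurable_phase_fract θ π k) 1 (fun _ => (norm_phase _ _ _).le)
    (ae_continuousAt_phase_fract θ π k)

/-- The real `y` reduces to `w / n` modulo one. -/
def ReducesTo {n : ℕ} (y : ℝ) (w : Fin n) : Prop := ∃ z : ℤ, y = ((w : ℕ) : ℝ) / n + z

namespace ReducesTo

variable {n : ℕ} {y y' : ℝ} {w w' : Fin n}

theorem fract_eq (h : ReducesTo y w) : Int.fract y = ((w : ℕ) : ℝ) / n := by
  have hn : (0 : ℝ) < n := by exact_mod_cast w.pos
  obtain ⟨z, rfl⟩ := h
  rw [Int.fract_add_intCast, Int.fract_eq_self]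
  refine ⟨by positivity, ?_⟩
  rw [div_lt_one hn]
  exact_mod_cast w.isLt

theorem add (h : ReducesTo y w) (h' : ReducesTo y' w') : ReducesTo (y + y') (w + w') := by
  have hn : (n : ℝ) ≠ 0 := by exact_mod_cast w.pos.ne'
  obtain ⟨z, rfl⟩ := h
  obtain ⟨z', rfl⟩ := h'
  obtain ⟨q, hq⟩ : ∃ q : ℕ, (w : ℕ) + w' = (w + w' : Fin n) + n * q :=
    ⟨_, by rw [Fin.val_add]; exact (Nat.mod_add_div _ _).symm⟩
  refine ⟨z + z' + q, ?_⟩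
  have h1 : ((w : ℕ) : ℝ) + (w' : ℕ) = (((w + w' : Fin n) : ℕ) : ℝ) + n * q := by
    exact_mod_cast hq
  push_cast at h1 ⊢
  field_simp
  linear_combination h1

variable [NeZero n]

theorem zero : ReducesTo 0 (0 : Fin n) := ⟨0, by simp⟩

theorem neg (h : ReducesTo y w) : ReducesTo (-y) (-w) := by
  have hn : (n : ℝ) ≠ 0 := by exact_mod_cast w.pos.ne'
  obtain ⟨z, rfl⟩ := h
  have h1 : ReducesTo (((w : ℕ) : ℝ) / n + (((-w : Fin n) : ℕ) : ℝ) / n) (w + -w) :=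
    add ⟨0, by simp⟩ ⟨0, by simp⟩
  rw [add_neg_cancel] at h1
  obtain ⟨z', h1⟩ := h1
  refine ⟨-z - z', ?_⟩
  push_cast
  simp at h1
  linear_combination -h1

theorem sum {S : Type*} (s : Finset S) {f : S → ℝ} {g : S → Fin n}
    (h : ∀ i ∈ s, ReducesTo (f i) (g i)) : ReducesTo (∑ i ∈ s, f i) (∑ i ∈ s, g i) := by
  classical
  induction s using Finset.induction_on with
  | empty => simpa using zero
  | insert i s hi ih =>
    rw [Finset.sum_insert hi, Finset.sum_insert hi]
    exact (h i (Finset.mem_insert_self i s)).add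
      (ih fun j hj => h j (Finset.mem_insert_of_mem hj))

end ReducesTo

/-- Wrapping around `ℤ/n` corresponds to dropping integer parts after division by `n`, so the sums
over `Fin n` are Riemann sums with no discretization error in the integrand. -/
theorem fract_linearForm_div (π : MixedPairPartition ε) {n : ℕ} [NeZero n]
    (x : FreeIndex ε → Fin n) (r : Fin (p + 1)) :
    Int.fract (linearForm π (fun i => ((x i : ℕ) : ℝ) / n) r)
      = ((walk ε (x none) (blockValue π x) r : Fin n) : ℕ) / n := by
  have h0 : ∀ w : Fin n, ReducesTo (((w : ℕ) : ℝ) / n) w := fun w => ⟨0, by simp⟩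
  rw [linearForm_eq_walk]
  refine ReducesTo.fract_eq ((h0 _).add (ReducesTo.sum _ fun s _ => ?_))
  split_ifs
  · obtain ⟨i, -, h⟩ : ∃ i : FreeIndex ε, i ≠ none ∧
        (blockValue π (fun i => ((x i : ℕ) : ℝ) / n) s = ((x i : ℕ) : ℝ) / n) ∧
        blockValue π x s = x i := by
      unfold blockValue
      split_ifs
      · exact ⟨_, Option.some_ne_none _, rfl, rfl⟩
      · exact ⟨_, Option.some_ne_none _, rfl, rfl⟩
    rw [h.1, h.2]
    cases ε s
    · exact h0 _
    · exact (h0 _).neg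
  · exact ReducesTo.zero

/-- The tuples that are constant along the blocks of a mixed pair partition, together with a base
point, are parametrized by the families indexed by `FreeIndex`. -/
theorem sum_blockValue {G : Type*} [Fintype G] [DecidableEq G] (π : MixedPairPartition ε)
    (F : G → (Fin p → G) → ℂ) :
    ∑ a : G, ∑ j : Fin p → G, (if ∀ s, j (π.1.1 s) = j s then F a j else 0)
      = ∑ x : FreeIndex ε → G, F (x none) (blockValue π x) := by
  simp only [← Finset.sum_filter]
  rw [← Finset.sum_product']
  symm
  refine Finset.sum_bij' (fun x _ => (x none, blockValue π x))
    (fun aj _ i => i.elim aj.1 fun s => aj.2 s.1) ?_ ?_ ?_ ?_ ?_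
  · intro x _
    refine Finset.mem_product.2 ⟨Finset.mem_univ _, Finset.mem_filter.2 ⟨Finset.mem_univ _, ?_⟩⟩
    intro s
    have h1 := π.2 s
    have h2 := (π.1.2 s).1
    simp only [blockValue]
    split_ifs with h3 h4 h4
    · simp_all
    · rfl
    · simp only [h2]
    · simp_all
  · exact fun _ _ => Finset.mem_univ _
  · intro x _
    funext i
    rcases i with _ | ⟨s, hs⟩
    · rfl
    · simp [blockValue, hs]
  · rintro ⟨a, j⟩ haj
    have hj := (Finset.mem_filter.1 (Finset.mem_product.1 haj).2).2
    refine Prod.ext rfl (funext fun s => ?_)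
    simp only [blockValue]
    split_ifs with h
    · rfl
    · exact hj s
  · exact fun _ _ => rfl

end PairingIntegral

/-! ### The limit of the normalized traces. -/

section TraceLimit

/-- Ones in `ZMod 2` cancel along the blocks. -/
theorem PairPartition.even {p : ℕ} (π : PairPartition p) : Even p := by
  have h : ∑ _s : Fin p, (1 : ZMod 2) = 0 :=
    Finset.sum_involution (fun s _ => π.1 s) (fun _ _ => by decide) (fun s _ _ => (π.2 s).2)
      (fun _ _ => Finset.mem_univ _) (fun s _ => (π.2 s).1)
  rw [Finset.sum_const, Finset.card_univ, Fintype.card_fin, nsmul_one] at h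
  exact (ZMod.natCast_eq_zero_iff_even).1 h

/-- For `p = 2m` the normalization is `n^{-(m+1)}`, the volume of a grid cell in the `m + 1`
variables. -/
theorem inv_mul_inv_sqrt_pow {p : ℕ} {ε : Fin p → Bool} (π : MixedPairPartition ε) (n : ℕ) :
    (n : ℂ)⁻¹ * (((√n)⁻¹ : ℝ) : ℂ) ^ p = ((n : ℂ) ^ Fintype.card (FreeIndex ε))⁻¹ := by
  obtain ⟨m, rfl⟩ := π.1.even.two_dvd
  rw [card_freeIndex π, pow_mul, ← Complex.ofReal_pow, inv_pow, Real.sq_sqrt (Nat.cast_nonneg n)]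
  push_cast
  rw [inv_pow, pow_succ, mul_inv, mul_comm]

variable {Ω : Type*} [MeasurableSpace Ω] {μ : Measure Ω} [IsProbabilityMeasure μ]
  {c : ℕ → Ω → ℂ}

theorem integral_trace_alternatingMonomial (hc : AssumptionI μ c) (θ : ℝ) (n : ℕ) [NeZero n]
    (t : ℝ) {p : ℕ} (ε : Fin p → Bool) (v : Fin (p + 1) → List Bool) :
    ∫ ω, (alternatingMonomial ((t : ℂ) • circ (fun j => c j ω) n) (diagD θ n) ε v).trace ∂μ
      = (t : ℂ) ^ p * ∑ a : Fin n, ∑ j : Fin p → Fin n,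
          (if ∑ s, signed (ε s) (j s) = 0 then mixedMoment μ c ε (fun s => (j s : ℕ)) else 0) *
            phase θ (fun r => netExponent (v r)) (fun r => ((walk ε a j r : Fin n) : ℕ) / n) := by
  have hint : ∀ (a : Fin n) (j : Fin p → Fin n), Integrable (fun ω =>
      if ∑ s, signed (ε s) (j s) = 0 then (∏ s, starPow (c (j s) ω) (ε s)) *
        phase θ (fun r => netExponent (v r)) (fun r => ((walk ε a j r : Fin n) : ℕ) / n)
      else 0) μ := by
    intro a j
    split_ifs
    · exact (integrable_prod_starPow hc ε _).mul_const _
    · exact integrable_zero _ _ _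
  simp only [trace_alternatingMonomial]
  rw [integral_const_mul,
    integral_finsetSum _ fun a _ => integrable_finsetSum _ fun j _ => hint a j]
  congr 1
  refine Finset.sum_congr rfl fun a _ => ?_
  rw [integral_finsetSum _ fun j _ => hint a j]
  refine Finset.sum_congr rfl fun j _ => ?_
  split_ifs
  · rw [integral_mul_const, mixedMoment]
  · simp

/-- An exact identity for each `n`: an error carried by `excess`, plus one Riemann sum per mixed
pair partition. For odd `p` the second sum is empty. -/
theorem normalized_trace_eq (hc : AssumptionI μ c) (θ : ℝ) (n : ℕ) [NeZero n] {p : ℕ}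
    (ε : Fin p → Bool) (v : Fin (p + 1) → List Bool) :
    (n : ℂ)⁻¹ * ∫ ω, (alternatingMonomial ((√n : ℂ)⁻¹ • circ (fun j => c j ω) n)
        (diagD θ n) ε v).trace ∂μ
      = (n : ℂ)⁻¹ * (((√n)⁻¹ : ℝ) : ℂ) ^ p * (∑ a : Fin n, ∑ j : Fin p → Fin n,
          excess μ c ε j * phase θ (fun r => netExponent (v r))
            (fun r => ((walk ε a j r : Fin n) : ℕ) / n))
        + ∑ π : MixedPairPartition ε, ((n : ℂ) ^ Fintype.card (FreeIndex ε))⁻¹ *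
            ∑ x : FreeIndex ε → Fin n, phase θ (fun r => netExponent (v r)) fun r =>
              Int.fract (linearForm π (fun i => ((x i : ℕ) : ℝ) / n) r) := by
  have hπ : ∀ π : MixedPairPartition ε, ((n : ℂ) ^ Fintype.card (FreeIndex ε))⁻¹ *
            ∑ x : FreeIndex ε → Fin n, phase θ (fun r => netExponent (v r)) (fun r =>
              Int.fract (linearForm π (fun i => ((x i : ℕ) : ℝ) / n) r))
      = (n : ℂ)⁻¹ * (((√n)⁻¹ : ℝ) : ℂ) ^ p * ∑ a : Fin n, ∑ j : Fin p → Fin n,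
          (if ∀ s, j (π.1.1 s) = j s then 1 else 0) * phase θ (fun r => netExponent (v r))
            (fun r => ((walk ε a j r : Fin n) : ℕ) / n) := by
    intro π
    rw [inv_mul_inv_sqrt_pow π]
    congr 1
    simp only [ite_mul, one_mul, zero_mul]
    rw [sum_blockValue π (fun a j => phase θ (fun r => netExponent (v r))
            (fun r => ((walk ε a j r : Fin n) : ℕ) / n))]
    refine Finset.sum_congr rfl fun x _ => ?_
    congr 1
    funext r
    exact fract_linearForm_div π x r
  rw [← Complex.ofReal_inv, integral_trace_alternatingMonomial hc,
    Finset.sum_congr rfl fun π _ => hπ π,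
    ← Finset.mul_sum, ← mul_add, mul_assoc]
  congr 2
  rw [Finset.sum_comm (s := (Finset.univ : Finset (MixedPairPartition ε))),
    ← Finset.sum_add_distrib]
  refine Finset.sum_congr rfl fun a _ => ?_
  rw [Finset.sum_comm (s := (Finset.univ : Finset (MixedPairPartition ε))),
    ← Finset.sum_add_distrib]
  refine Finset.sum_congr rfl fun j _ => ?_
  rw [← Finset.sum_mul, ← add_mul, excess, sub_add_cancel]

/-- The limit of the normalized trace of a monomial in the scaled circulant matrix and the
diagonal matrix `diagD θ`. -/
theorem tendsto_normalized_trace (hc : AssumptionI μ c) (θ : ℝ) {p : ℕ}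
    (ε : Fin p → Bool) (v : Fin (p + 1) → List Bool) :
    Tendsto (fun n : ℕ => ((n + 1 : ℕ) : ℂ)⁻¹ * ∫ ω, (alternatingMonomial
        ((√(n + 1 : ℕ) : ℂ)⁻¹ • circ (fun j => c j ω) (n + 1)) (diagD θ (n + 1)) ε v).trace ∂μ)
      atTop (𝓝 (∑ π : MixedPairPartition ε, pairingIntegral θ π fun r => netExponent (v r))) := by
  simp only [normalized_trace_eq hc]
  rw [← zero_add (∑ π : MixedPairPartition ε, _)]
  refine Tendsto.add ?_ (tendsto_finsetSum _ fun π _ => tendsto_pairingIntegral θ π _)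
  -- The error is at most `K / √n`, since the phases have modulus one.
  obtain ⟨K, hK0, hK⟩ := exists_norm_sum_excess_le hc ε
  have hlim : Tendsto (fun n : ℕ => K * (√(n + 1 : ℕ))⁻¹) atTop (𝓝 0) := by
    rw [← mul_zero K]
    refine Tendsto.const_mul K (tendsto_inv_atTop_zero.comp (Real.tendsto_sqrt_atTop.comp ?_))
    exact tendsto_natCast_atTop_atTop.comp (tendsto_add_atTop_nat 1)
  refine squeeze_zero_norm (fun n => ?_) hlim
  have hn : (0 : ℝ) < (n + 1 : ℕ) := by positivity
  have hs : 0 < √(n + 1 : ℕ) := Real.sqrt_pos.2 hn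
  have h := hK (n + 1) (fun a j => phase θ (fun r => netExponent (v r))
    (fun r => ((walk ε a j r : Fin (n + 1)) : ℕ) / (n + 1 : ℕ))) fun a j => (norm_phase _ _ _).le
  rw [norm_mul, norm_mul, norm_pow, norm_inv, Complex.norm_natCast, Complex.norm_real,
    Real.norm_of_nonneg (inv_nonneg.2 hs.le), ← le_div_iff₀ hs] at *
  refine (mul_le_mul_of_nonneg_left h (by positivity)).trans (le_of_eq ?_)
  rw [inv_pow]
  field_simp

end TraceLimit

/-! ### Moments of the two limit laws. -/

section Laws

theorem integral_Ioo_exp_int_mul (m : ℤ) :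
    ∫ t in Set.Ioo (-Real.pi) Real.pi, Complex.exp (Complex.I * ((m : ℝ) * t : ℝ))
      = if m = 0 then 2 * (Real.pi : ℂ) else 0 := by
  rw [← integral_Ioc_eq_integral_Ioo,
    ← intervalIntegral.integral_of_le (by linarith [Real.pi_pos])]
  split_ifs with h
  · simp [h]
    ring
  · have hm : (m : ℂ) * Complex.I ≠ 0 := mul_ne_zero (by exact_mod_cast h) Complex.I_ne_zero
    have h1 : ∀ t : ℝ, Complex.exp (Complex.I * ((m : ℝ) * t : ℝ))
        = Complex.exp (m * Complex.I * t) := fun t => by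
      congr 1
      push_cast
      ring
    simp only [h1]
    rw [integral_exp_mul_complex hm, div_eq_zero_iff, sub_eq_zero]
    left
    rw [Complex.exp_eq_exp_iff_exists_int]
    refine ⟨m, ?_⟩
    push_cast
    ring

theorem integral_Ioi_pow_mul_exp_neg_sq (k : ℕ) :
    ∫ r in Set.Ioi (0 : ℝ), r ^ (2 * k + 1) * Real.exp (-r ^ 2) = (k.factorial : ℝ) / 2 := by
  have h := integral_rpow_mul_exp_neg_rpow (p := 2) (q := 2 * k + 1) (by norm_num)
    (by have : (0 : ℝ) ≤ k := Nat.cast_nonneg k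
        linarith)
  have h2 : ((2 * k + 1 : ℝ) + 1) / 2 = k + 1 := by ring
  rw [h2, Real.Gamma_nat_eq_factorial] at h
  rw [div_eq_inv_mul, ← one_div, ← h]
  refine setIntegral_congr_fun measurableSet_Ioi fun r _ => ?_
  norm_cast

/-- Variance `1/2` in each coordinate makes the joint density `π⁻¹ exp(-|z|²)`. -/
theorem integral_stdComplexGaussianLaw (f : ℂ → ℂ) (hf : Continuous f) :
    ∫ z, f z ∂stdComplexGaussianLaw = ∫ q : ℝ × ℝ,
      ((Real.pi⁻¹ * Real.exp (-(q.1 ^ 2 + q.2 ^ 2)) : ℝ) : ℂ) * f (q.1 + q.2 * Complex.I) := by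
  have hv : (1 / 2 : NNReal) ≠ 0 := by norm_num
  have hg : Continuous fun p : ℝ × ℝ => (p.1 : ℂ) + (p.2 : ℂ) * Complex.I := by fun_prop
  rw [stdComplexGaussianLaw, integral_map hg.aemeasurable hf.aestronglyMeasurable,
    gaussianReal_of_var_ne_zero _ hv,
    prod_withDensity (measurable_gaussianPDF _ _) (measurable_gaussianPDF _ _),
    integral_withDensity_eq_integral_toReal_smul]
  · refine integral_congr_ae (Eventually.of_forall fun q => ?_)
    simp only [ENNReal.toReal_mul, toReal_gaussianPDF, Complex.real_smul]
    congr 2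
    have h2 : (2 : ℝ) * Real.pi * ((1 / 2 : NNReal) : ℝ) = Real.pi := by
      push_cast
      ring
    have h3 : (2 : ℝ) * ((1 / 2 : NNReal) : ℝ) = 1 := by
      push_cast
      ring
    rw [gaussianPDFReal, gaussianPDFReal, h2, h3, neg_add, Real.exp_add]
    have h4 := Real.mul_self_sqrt Real.pi_pos.le
    simp only [sub_zero, div_one]
    rw [mul_mul_mul_comm, ← mul_inv, h4]
  · exact ((measurable_gaussianPDF _ _).comp measurable_fst).mul
      ((measurable_gaussianPDF _ _).comp measurable_snd)
  · exact Eventually.of_forall fun q =>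
      ENNReal.mul_lt_top gaussianPDF_lt_top gaussianPDF_lt_top

/-- In polar coordinates the angular integral vanishes unless `k = l`, when it is `2π`; the radial
one is then a Gamma integral equal to `k!/2`. -/
theorem moment_stdComplexGaussianLaw (k l : ℕ) :
    ∫ z, z ^ k * (starRingEnd ℂ z) ^ l ∂stdComplexGaussianLaw
      = if k = l then (k.factorial : ℂ) else 0 := by
  rw [integral_stdComplexGaussianLaw _ (by fun_prop), ← integral_comp_polarCoord_symm,
    polarCoord_target]
  have h : ∀ q : ℝ × ℝ, q.1 • (((Real.pi⁻¹ * Real.exp (-((polarCoord.symm q).1 ^ 2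
        + (polarCoord.symm q).2 ^ 2)) : ℝ) : ℂ) *
      ((((polarCoord.symm q).1 : ℂ) + (polarCoord.symm q).2 * Complex.I) ^ k *
        (starRingEnd ℂ ((polarCoord.symm q).1 + (polarCoord.symm q).2 * Complex.I)) ^ l))
      = ((Real.pi⁻¹ * (q.1 ^ (k + l + 1) * Real.exp (-q.1 ^ 2)) : ℝ) : ℂ) *
        Complex.exp (Complex.I * ((((k : ℤ) - l : ℤ) : ℝ) * q.2 : ℝ)) := by
    rintro ⟨r, t⟩
    have h1 : (((polarCoord.symm (r, t)).1 : ℂ) + (polarCoord.symm (r, t)).2 * Complex.I)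
        = r * Complex.exp (t * Complex.I) := by
      rw [polarCoord_symm_apply, Complex.exp_mul_I]
      push_cast
      ring
    have h2 : (polarCoord.symm (r, t)).1 ^ 2 + (polarCoord.symm (r, t)).2 ^ 2 = r ^ 2 := by
      rw [polarCoord_symm_apply]
      simp only
      linear_combination r ^ 2 * Real.cos_sq_add_sin_sq t
    have h3 : Complex.exp (Complex.I * ((((k : ℤ) - l : ℤ) : ℝ) * t : ℝ))
        = Complex.exp (t * Complex.I) ^ k * Complex.exp (-(t * Complex.I)) ^ l := by
      rw [← Complex.exp_nat_mul, ← Complex.exp_nat_mul, ← Complex.exp_add]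
      congr 1
      push_cast
      ring
    rw [h1, h2, h3, map_mul, ← Complex.exp_conj, map_mul, Complex.conj_ofReal,
      Complex.conj_ofReal, Complex.conj_I, mul_neg, Complex.real_smul]
    push_cast
    ring
  simp only [h]
  rw [Measure.volume_eq_prod, setIntegral_prod_mul (fun r : ℝ =>
    ((Real.pi⁻¹ * (r ^ (k + l + 1) * Real.exp (-r ^ 2)) : ℝ) : ℂ))
    (fun t : ℝ => Complex.exp (Complex.I * ((((k : ℤ) - l : ℤ) : ℝ) * t : ℝ))),
    integral_Ioo_exp_int_mul]
  by_cases hkl : k = l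
  · subst hkl
    have h4 : ∫ r in Set.Ioi (0 : ℝ),
        ((Real.pi⁻¹ * (r ^ (k + k + 1) * Real.exp (-r ^ 2)) : ℝ) : ℂ)
        = ((∫ r in Set.Ioi (0 : ℝ), Real.pi⁻¹ * (r ^ (k + k + 1) * Real.exp (-r ^ 2)) : ℝ) : ℂ) :=
      integral_ofReal
    have hpi : (Real.pi : ℂ) ≠ 0 := by exact_mod_cast Real.pi_ne_zero
    rw [h4, integral_const_mul, ← two_mul, integral_Ioi_pow_mul_exp_neg_sq, if_pos (by simp),
      if_pos rfl]
    push_cast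
    field_simp
  · rw [if_neg (by omega), if_neg hkl, mul_zero]

/-- A mixed pair partition is a bijection from the unstarred to the starred positions. -/
def mixedPairPartitionEquiv {p : ℕ} (ε : Fin p → Bool) :
    MixedPairPartition ε ≃ ({s : Fin p // ε s = false} ≃ {s : Fin p // ¬ ε s = false}) where
  toFun π :=
    { toFun := fun s => ⟨π.1.1 s.1, fun h => π.2 s.1 (h.trans s.2.symm)⟩
      invFun := fun s => ⟨π.1.1 s.1, by
        have h1 := π.2 s.1
        have h2 := s.2
        revert h1 h2
        cases ε (π.1.1 s.1) <;> cases ε s.1 <;> simp⟩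
      left_inv := fun s => Subtype.ext (π.1.2 s.1).1
      right_inv := fun s => Subtype.ext (π.1.2 s.1).1 }
  invFun e :=
    let f : Fin p → Fin p := fun s =>
      if h : ε s = false then (e ⟨s, h⟩).1 else (e.symm ⟨s, h⟩).1
    have hf : ∀ s, ε (f s) ≠ ε s := fun s => by
      by_cases h : ε s = false
      · simpa only [f, dif_pos h, h] using (e ⟨s, h⟩).2
      · simp only [f, dif_neg h, (e.symm ⟨s, h⟩).2]
        exact fun h' => h h'.symm
    have hinv : Function.Involutive f := fun s => by
      by_cases h : ε s = false
      · have h' : ¬ ε (f s) = false := fun h' => hf s (h'.trans h.symm)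
        have h2 : (⟨f s, h'⟩ : {s : Fin p // ¬ ε s = false}) = e ⟨s, h⟩ :=
          Subtype.ext (by simp only [f, dif_pos h])
        calc f (f s) = (e.symm ⟨f s, h'⟩).1 := dif_neg h'
          _ = s := by rw [h2, Equiv.symm_apply_apply]
      · have h2 : (⟨f s, by simp only [f, dif_neg h, (e.symm ⟨s, h⟩).2]⟩ :
            {s : Fin p // ε s = false}) = e.symm ⟨s, h⟩ :=
          Subtype.ext (by simp only [f, dif_neg h])
        have h' : ε (f s) = false := by simp only [f, dif_neg h, (e.symm ⟨s, h⟩).2]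
        calc f (f s) = (e ⟨f s, h'⟩).1 := dif_pos h'
          _ = s := by rw [h2, Equiv.apply_symm_apply]
    ⟨⟨hinv.toPerm, fun s => ⟨hinv s, fun h => hf s (congrArg ε h)⟩⟩, hf⟩
  left_inv π := by
    refine Subtype.ext (Subtype.ext (Equiv.ext fun s => ?_))
    change (if h : ε s = false then _ else _) = _
    split_ifs <;> rfl
  right_inv e := by
    refine Equiv.ext fun s => Subtype.ext ?_
    change (if h : ε s.1 = false then _ else _) = _
    rw [dif_pos s.2]

/-- Bijections between the `k` unstarred and `l` starred positions are counted; the result matches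
the Gaussian moments. -/
theorem card_mixedPairPartition {p : ℕ} (ε : Fin p → Bool) (k l : ℕ)
    (hk : Fintype.card {s : Fin p // ε s = false} = k) (hp : p = k + l) :
    Fintype.card (MixedPairPartition ε) = if k = l then k.factorial else 0 := by
  classical
  have hl : Fintype.card {s : Fin p // ¬ ε s = false} = l := by
    rw [Fintype.card_subtype_compl, hk, Fintype.card_fin]
    omega
  rw [Fintype.card_congr (mixedPairPartitionEquiv ε)]
  split_ifs with h
  · have e : {s : Fin p // ε s = false} ≃ {s : Fin p // ¬ ε s = false} :=
      Fintype.equivOfCardEq (by rw [hk, hl, h])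
    rw [Fintype.card_equiv e, hk]
  · rw [Fintype.card_eq_zero_iff]
    exact ⟨fun e => h (by rw [← hk, ← hl, Fintype.card_congr e])⟩

theorem pairingIntegral_zero (θ : ℝ) {p : ℕ} {ε : Fin p → Bool} (π : MixedPairPartition ε) :
    pairingIntegral θ π (fun _ => 0) = 1 := by
  simp [pairingIntegral, measureReal_def, Real.volume_Icc_pi]

theorem netExponent_replicate (k l : ℕ) :
    netExponent (List.replicate k false ++ List.replicate l true) = (k : ℤ) - l := by
  simp [netExponent, List.count_append, List.count_replicate]

theorem card_get_replicate (k l : ℕ) :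
    Fintype.card {s : Fin (List.replicate k false ++ List.replicate l true).length //
      (List.replicate k false ++ List.replicate l true).get s = false} = k := by
  rw [Fintype.card_subtype]
  have h := Fin.card_filter_univ_eq_vector_get_eq_count false
    (⟨List.replicate k false ++ List.replicate l true, rfl⟩ : List.Vector Bool _)
  refine Eq.trans h ?_
  simp [List.Vector.toList, List.count_replicate]

theorem starMonomialOne_replicate {A : Type*} [Monoid A] [Star A] (a : A) (k l : ℕ) :
    starMonomialOne a (List.replicate k false ++ List.replicate l true) = a ^ k * star a ^ l := by
  simp [starMonomialOne, starPow]

theorem alternatingMonomial_get {A : Type*} [Monoid A] [Star A] (N d : A) (w : List Bool) :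
    alternatingMonomial N d w.get (fun _ => []) = starMonomialOne N w := by
  rw [alternatingMonomial, starMonomialOne]
  simp only [starMonomialOne, List.map_nil, List.prod_nil, one_mul, mul_one]
  congr 1
  conv_rhs => rw [← List.ofFn_get w, List.map_ofFn]
  rfl

theorem moment_expUniformLaw (θ : ℝ) (k l : ℕ) :
    ∫ z, z ^ k * (starRingEnd ℂ z) ^ l ∂expUniformLaw θ
      = ∫ u in Set.Icc (0 : ℝ) 1,
          Complex.exp (Complex.I * θ * ((((k : ℤ) - l : ℤ) : ℝ) * u : ℝ)) := by
  rw [expUniformLaw, integral_map (by fun_prop)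
    (Continuous.aestronglyMeasurable (by fun_prop))]
  refine integral_congr_ae (Eventually.of_forall fun u => ?_)
  simp only
  rw [← Complex.exp_conj, ← Complex.exp_nat_mul, ← Complex.exp_nat_mul, ← Complex.exp_add]
  congr 1
  simp
  ring

/-- Without steps only the base point is integrated, and the fractional part is the identity on
`[0,1)`; hence the passage to half-open intervals. -/
theorem pairingIntegral_of_isEmpty (θ : ℝ) {ε : Fin 0 → Bool} (π : MixedPairPartition ε)
    (k : Fin 1 → ℤ) :
    pairingIntegral θ π k
      = ∫ u in Set.Icc (0 : ℝ) 1, Complex.exp (Complex.I * θ * (((k 0 : ℤ) : ℝ) * u : ℝ)) := by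
  let _ : Unique (FreeIndex ε) :=
    { default := none
      uniq := fun i => by
        rcases i with _ | ⟨s, _⟩
        · rfl
        · exact s.elim0 }
  have hmp := volume_preserving_funUnique (FreeIndex ε) ℝ
  rw [integral_Icc_eq_integral_Ico,
    ← hmp.setIntegral_preimage_emb (MeasurableEquiv.measurableEmbedding _), pairingIntegral]
  have hset : (MeasurableEquiv.funUnique (FreeIndex ε) ℝ) ⁻¹' Set.Ico (0 : ℝ) 1
      = Set.univ.pi fun _ : FreeIndex ε => Set.Ico (0 : ℝ) 1 := by
    ext x
    simp [Set.mem_pi, Unique.forall_iff]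
  have hae : (Set.univ.pi fun _ : FreeIndex ε => Set.Ico (0 : ℝ) 1)
      =ᵐ[volume] Set.Icc (0 : FreeIndex ε → ℝ) 1 := Measure.univ_pi_Ico_ae_eq_Icc
  rw [hset, ← setIntegral_congr_set hae]
  refine setIntegral_congr_fun (MeasurableSet.univ_pi fun _ => measurableSet_Ico) fun x hx => ?_
  have h0 : linearForm π x 0 = x none := by simp [linearForm]
  have hx0 : Int.fract (x none) = x none := Int.fract_eq_self.2 (hx none (Set.mem_univ _))
  have hsum : ∑ r : Fin (0 + 1), (k r : ℝ) * Int.fract (linearForm π x r) = k 0 * x none :=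
    (Fin.sum_univ_one _).trans (by rw [h0, hx0])
  simp only [hsum]
  rfl

end Laws

/-! ### Words in alternating form and the limit space. -/

section LimitSpace

theorem map_starPow {A B : Type*} [Monoid A] [Star A] [Monoid B] [Star B] (f : A →* B)
    (hf : ∀ a, f (star a) = star (f a)) (a : A) (e : Bool) :
    f (starPow a e) = starPow (f a) e := by
  cases e
  · rfl
  · exact hf a

theorem map_starMonomial {A B ι : Type*} [Monoid A] [Star A] [Monoid B] [Star B] (f : A →* B)
    (hf : ∀ a, f (star a) = star (f a)) (a : ι → A) (w : List (ι × Bool)) :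
    f (starMonomial a w) = starMonomial (fun i => f (a i)) w := by
  simp only [starMonomial, map_list_prod, List.map_map, Function.comp_def, map_starPow f hf]

theorem map_starMonomialOne {A B : Type*} [Monoid A] [Star A] [Monoid B] [Star B] (f : A →* B)
    (hf : ∀ a, f (star a) = star (f a)) (a : A) (w : List Bool) :
    f (starMonomialOne a w) = starMonomialOne (f a) w := by
  simp only [starMonomialOne, map_list_prod, List.map_map, Function.comp_def, map_starPow f hf]

theorem map_alternatingMonomial {A B : Type*} [Monoid A] [Star A] [Monoid B] [Star B]
    (f : A →* B) (hf : ∀ a, f (star a) = star (f a)) (N d : A) {p : ℕ} (ε : Fin p → Bool)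
    (v : Fin (p + 1) → List Bool) :
    f (alternatingMonomial N d ε v) = alternatingMonomial (f N) (f d) ε v := by
  simp only [alternatingMonomial, map_mul, map_list_prod, List.map_ofFn, Function.comp_def,
    map_starPow f hf, map_starMonomialOne f hf]

/-- Building the word from the right, a letter `N` opens a new empty slot in front, while a letter
`d` joins the first slot. -/
theorem exists_alternatingMonomial_eq {A : Type*} [Monoid A] [Star A] (N d : A)
    (w : List (Fin 2 × Bool)) :
    ∃ (p : ℕ) (ε : Fin p → Bool) (v : Fin (p + 1) → List Bool),
      starMonomial ![N, d] w = alternatingMonomial N d ε v := by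
  induction w with
  | nil => exact ⟨0, Fin.elim0, fun _ => [], by
      simp [starMonomial, alternatingMonomial, starMonomialOne]⟩
  | cons l w ih =>
    obtain ⟨p, ε, v, h⟩ := ih
    obtain ⟨i, e⟩ := l
    have hcons : starMonomial ![N, d] ((i, e) :: w)
        = starPow (![N, d] i) e * starMonomial ![N, d] w := by
      simp [starMonomial]
    rw [hcons, h]
    fin_cases i
    · refine ⟨p + 1, Fin.cons e ε, Fin.cons [] v, ?_⟩
      rw [alternatingMonomial, alternatingMonomial, List.ofFn_succ, List.prod_cons]
      simp [starMonomialOne, mul_assoc]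
    · refine ⟨p, ε, Fin.cons (e :: v 0) (Fin.tail v), ?_⟩
      rw [alternatingMonomial, alternatingMonomial]
      simp [starMonomialOne, mul_assoc, Fin.tail]

/-- The sequences of matrices of growing size that depend on the input sequence `c`. -/
abbrev MatrixSequence : Type := ∀ n : ℕ, (ℕ → ℂ) → Matrix (Fin (n + 1)) (Fin (n + 1)) ℂ

namespace MatrixSequence

/-- The sequence of the scaled circulant matrices. -/
noncomputable def circulant : MatrixSequence := fun n c => (√(n + 1 : ℕ) : ℂ)⁻¹ • circ c (n + 1)

/-- The sequence of the matrices `diagD θ`. -/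
noncomputable def diagonal (θ : ℝ) : MatrixSequence := fun n _ => diagD θ (n + 1)

/-- Evaluation of a sequence of matrices. -/
def eval (n : ℕ) (x : ℕ → ℂ) : MatrixSequence →* Matrix (Fin (n + 1)) (Fin (n + 1)) ℂ where
  toFun X := X n x
  map_one' := rfl
  map_mul' _ _ := rfl

/-- The adjoint of a circulant matrix is circulant, and circulant matrices commute. -/
theorem isStarNormal_circulant : IsStarNormal circulant := by
  have hcirc : ∀ (c : ℕ → ℂ) (n : ℕ),
      circ c (n + 1) = Matrix.circulant fun i : Fin (n + 1) => c ((-i : Fin (n + 1)) : ℕ) := by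
    intro c n
    ext i j
    rw [Matrix.circulant_apply, neg_sub, Fin.val_sub]
    change c _ = c _
    congr 2
    have := i.isLt
    omega
  refine ⟨funext fun n => funext fun c => ?_⟩
  change star (circulant n c) * circulant n c = circulant n c * star (circulant n c)
  rw [circulant, star_smul, smul_mul_smul_comm, smul_mul_smul_comm, mul_comm, hcirc,
    Matrix.star_eq_conjTranspose, Matrix.conjTranspose_circulant, Matrix.circulant_mul_comm]

theorem isStarNormal_diagonal (θ : ℝ) : IsStarNormal (diagonal θ) := by
  refine ⟨funext fun n => funext fun c => ?_⟩
  change star (diagD θ (n + 1)) * diagD θ (n + 1) = diagD θ (n + 1) * star (diagD θ (n + 1))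
  rw [diagD, Matrix.star_eq_conjTranspose, Matrix.diagonal_conjTranspose,
    Matrix.diagonal_mul_diagonal, Matrix.diagonal_mul_diagonal]
  simp only [mul_comm]

variable {Ω : Type*} [MeasurableSpace Ω]

/-- The normalized expected trace of the `n`-th matrix of a sequence. -/
noncomputable def normalizedTrace (μ : Measure Ω) (c : ℕ → Ω → ℂ) (n : ℕ)
    (X : MatrixSequence) : ℂ :=
  ((n + 1 : ℕ) : ℂ)⁻¹ * ∫ ω, (X n (fun j => c j ω)).trace ∂μ

/-- The sequences with integrable traces whose normalized expected traces converge. -/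
def convergent (μ : Measure Ω) (c : ℕ → Ω → ℂ) : Submodule ℂ MatrixSequence where
  carrier := {X | (∀ n, Integrable (fun ω => (X n (fun j => c j ω)).trace) μ) ∧
    ∃ L, Tendsto (fun n => normalizedTrace μ c n X) atTop (𝓝 L)}
  zero_mem' := ⟨fun n => by simp, 0, by simp [normalizedTrace]⟩
  add_mem' := by
    rintro X Y ⟨hX, L, hL⟩ ⟨hY, M, hM⟩
    -- Integrability belongs to the definition because additivity of the integral needs it.
    refine ⟨fun n => by simpa using! (hX n).add (hY n), L + M, (hL.add hM).congr fun n => ?_⟩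
    simp only [normalizedTrace, Pi.add_apply, Matrix.trace_add]
    rw [integral_add (hX n) (hY n), mul_add]
  smul_mem' := by
    rintro r X ⟨hX, L, hL⟩
    refine ⟨fun n => by simpa using! (hX n).const_mul r, r * L,
      (hL.const_mul r).congr fun n => ?_⟩
    simp only [normalizedTrace, Pi.smul_apply, Matrix.trace_smul, smul_eq_mul]
    rw [integral_const_mul]
    ring

/-- The limit of the normalized expected traces. -/
noncomputable def limitTrace (μ : Measure Ω) (c : ℕ → Ω → ℂ) : convergent μ c →ₗ[ℂ] ℂ where
  toFun X := limUnder atTop fun n => normalizedTrace μ c n X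
  map_add' X Y := by
    obtain ⟨hX, L, hL⟩ := X.2
    obtain ⟨hY, M, hM⟩ := Y.2
    rw [hL.limUnder_eq, hM.limUnder_eq]
    refine ((hL.add hM).congr fun n => ?_).limUnder_eq
    simp only [normalizedTrace, Submodule.coe_add, Pi.add_apply, Matrix.trace_add]
    rw [integral_add (hX n) (hY n), mul_add]
  map_smul' r X := by
    obtain ⟨hX, L, hL⟩ := X.2
    rw [hL.limUnder_eq]
    refine ((hL.const_mul r).congr fun n => ?_).limUnder_eq
    simp only [normalizedTrace, Submodule.coe_smul, Pi.smul_apply, Matrix.trace_smul, smul_eq_mul]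
    rw [integral_const_mul]
    ring

/-- The `*`-algebra generated by the circulant and diagonal sequences. -/
noncomputable abbrev generated (θ : ℝ) : StarSubalgebra ℂ MatrixSequence :=
  StarAlgebra.adjoin ℂ {circulant, diagonal θ}

theorem exists_starMonomial_of_mem_closure {A : Type*} [Monoid A] [InvolutiveStar A] (N d : A)
    {x : A} (hx : x ∈ Submonoid.closure (({N, d} : Set A) ∪ star {N, d})) :
    ∃ w, x = starMonomial ![N, d] w := by
  induction hx using Submonoid.closure_induction_left with
  | one => exact ⟨[], rfl⟩
  | mul_left a ha y _ ih =>
    obtain ⟨w, rfl⟩ := ih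
    have h : ∃ l : Fin 2 × Bool, a = starPow (![N, d] l.1) l.2 := by
      rcases ha with (rfl | rfl) | h
      · exact ⟨(0, false), rfl⟩
      · exact ⟨(1, false), rfl⟩
      · rcases h with h | h
        · exact ⟨(0, true), by rw [← star_star a, h]; rfl⟩
        · exact ⟨(1, true), by rw [← star_star a, h]; rfl⟩
    obtain ⟨l, rfl⟩ := h
    exact ⟨l :: w, by simp [starMonomial]⟩

variable {μ : Measure Ω} [IsProbabilityMeasure μ] {c : ℕ → Ω → ℂ}

theorem coe_starMonomial_apply (hc : AssumptionI μ c) (θ : ℝ) (n : ℕ)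
    (w : List (Fin 2 × Bool)) (ω : Ω) :
    (starMonomial ![scaledCirculant hc (n + 1), deterministicD μ θ (n + 1)] w :
        randomMatrices μ (n + 1)).1 ω
      = starMonomial ![circulant, diagonal θ] w n (fun j => c j ω) := by
  let f : randomMatrices μ (n + 1) →* Matrix (Fin (n + 1)) (Fin (n + 1)) ℂ :=
    { toFun := fun X => X.1 ω
      map_one' := rfl
      map_mul' := fun _ _ => rfl }
  refine (map_starMonomial f (fun _ => rfl) _ w).trans
    (Eq.trans ?_ (map_starMonomial (eval n fun j => c j ω) (fun _ => rfl) _ w).symm)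
  congr 1
  funext i
  fin_cases i <;> rfl

theorem state_starMonomial (hc : AssumptionI μ c) (θ : ℝ) (n : ℕ) (w : List (Fin 2 × Bool)) :
    (randomMatrixSpace μ (n + 1)).state
        (starMonomial ![scaledCirculant hc (n + 1), deterministicD μ θ (n + 1)] w)
      = normalizedTrace μ c n (starMonomial ![circulant, diagonal θ] w) := by
  exact congrArg (fun g : Ω → ℂ => ((n + 1 : ℕ) : ℂ)⁻¹ * ∫ ω, g ω ∂μ)
    (funext fun ω => congrArg Matrix.trace (coe_starMonomial_apply hc θ n w ω))

theorem integrable_trace_starMonomial (hc : AssumptionI μ c) (θ : ℝ) (n : ℕ)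
    (w : List (Fin 2 × Bool)) :
    Integrable (fun ω => (starMonomial ![circulant, diagonal θ] w n (fun j => c j ω)).trace) μ := by
  simp only [← coe_starMonomial_apply hc]
  exact integrable_finsetSum _ fun i _ => memLp_one_iff_integrable.1 (by
    simpa using! (starMonomial ![scaledCirculant hc (n + 1), deterministicD μ θ (n + 1)] w :
        randomMatrices μ (n + 1)).2 i i 1)

theorem tendsto_normalizedTrace_alternatingMonomial (hc : AssumptionI μ c) (θ : ℝ) {p : ℕ}
    (ε : Fin p → Bool) (v : Fin (p + 1) → List Bool) :
    Tendsto (fun n => normalizedTrace μ c n (alternatingMonomial circulant (diagonal θ) ε v))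
      atTop (𝓝 (∑ π : MixedPairPartition ε, pairingIntegral θ π fun r => netExponent (v r))) := by
  refine (tendsto_normalized_trace hc θ ε v).congr fun n => ?_
  rw [normalizedTrace]
  congr 2
  funext ω
  exact congrArg Matrix.trace
    (map_alternatingMonomial (eval n fun j => c j ω) (fun _ => rfl) circulant (diagonal θ) ε v).symm

/-- The generated `*`-algebra is spanned by words, so convergence on words suffices even though
`convergent` is only a subspace. -/
theorem generated_le_convergent (hc : AssumptionI μ c) (θ : ℝ) :
    Subalgebra.toSubmodule (generated θ).toSubalgebra ≤ convergent μ c := by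
  rw [StarAlgebra.adjoin_eq_span, Submodule.span_le]
  intro x hx
  obtain ⟨w, rfl⟩ := exists_starMonomial_of_mem_closure _ _ hx
  refine ⟨fun n => integrable_trace_starMonomial hc θ n w, ?_⟩
  obtain ⟨p, ε, v, h⟩ := exists_alternatingMonomial_eq circulant (diagonal θ) w
  rw [h]
  exact ⟨_, tendsto_normalizedTrace_alternatingMonomial hc θ ε v⟩

/-- The `*`-probability space generated by the circulant and diagonal sequences, with the limit
of the normalized expected traces as its state. -/
noncomputable def limitSpace (hc : AssumptionI μ c) (θ : ℝ) : StarProbSpace.{0} where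
  carrier := generated θ
  state := (limitTrace μ c).comp (Submodule.inclusion (generated_le_convergent hc θ))
  state_one := by
    refine Tendsto.limUnder_eq (tendsto_const_nhds.congr fun n => ?_)
    change 1 = ((n + 1 : ℕ) : ℂ)⁻¹ *
      ∫ ω, (1 : Matrix (Fin (n + 1)) (Fin (n + 1)) ℂ).trace ∂μ
    have : ((n + 1 : ℕ) : ℂ) ≠ 0 := by exact_mod_cast n.succ_ne_zero
    rw [Matrix.trace_one, Fintype.card_fin, integral_const, probReal_univ, one_smul,
      inv_mul_cancel₀ this]

/-- The circulant sequence as an element of the limit space. -/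
noncomputable def limitN (hc : AssumptionI μ c) (θ : ℝ) : (limitSpace hc θ).carrier :=
  (⟨circulant, StarAlgebra.subset_adjoin ℂ _ (Set.mem_insert _ _)⟩ : generated θ)

/-- The diagonal sequence as an element of the limit space. -/
noncomputable def limitD (hc : AssumptionI μ c) (θ : ℝ) : (limitSpace hc θ).carrier :=
  (⟨diagonal θ, StarAlgebra.subset_adjoin ℂ _ (Set.mem_insert_of_mem _ rfl)⟩ : generated θ)

/-- The inclusion of the limit space into the sequences of matrices. -/
def limitSpaceVal (hc : AssumptionI μ c) (θ : ℝ) : (limitSpace hc θ).carrier →* MatrixSequence where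
  toFun X := (show generated θ from X).1
  map_one' := rfl
  map_mul' _ _ := rfl

theorem state_limitSpace (hc : AssumptionI μ c) (θ : ℝ) (X : (limitSpace hc θ).carrier) {L : ℂ}
    (h : Tendsto (fun n => normalizedTrace μ c n (limitSpaceVal hc θ X)) atTop (𝓝 L)) :
    (limitSpace hc θ).state X = L :=
  h.limUnder_eq

theorem state_alternatingMonomial (hc : AssumptionI μ c) (θ : ℝ) {p : ℕ}
    (ε : Fin p → Bool) (v : Fin (p + 1) → List Bool) :
    (limitSpace hc θ).state (alternatingMonomial (limitN hc θ) (limitD hc θ) ε v)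
      = ∑ π : MixedPairPartition ε, pairingIntegral θ π fun r => netExponent (v r) := by
  refine state_limitSpace hc θ _ ?_
  rw [map_alternatingMonomial _ fun _ => rfl]
  exact tendsto_normalizedTrace_alternatingMonomial hc θ ε v

theorem convergesInStarDistribution (hc : AssumptionI μ c) (θ : ℝ) :
    ConvergesInStarDistribution (fun n => randomMatrixSpace μ (n + 1))
      (fun n => ![scaledCirculant hc (n + 1), deterministicD μ θ (n + 1)]) (limitSpace hc θ)
      ![limitN hc θ, limitD hc θ] := by
  intro w
  obtain ⟨p, ε, v, h⟩ := exists_alternatingMonomial_eq (limitN hc θ) (limitD hc θ) w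
  rw [h, state_alternatingMonomial]
  simp only [state_starMonomial]
  -- The form `ε`, `v` was chosen in the limit space; applying the inclusion to `h` gives the same
  -- form for the sequences.
  have h' : starMonomial ![circulant, diagonal θ] w
      = alternatingMonomial circulant (diagonal θ) ε v := by
    have h1 := congrArg (limitSpaceVal hc θ) h
    rw [map_starMonomial _ fun _ => rfl, map_alternatingMonomial _ fun _ => rfl] at h1
    refine Eq.trans ?_ h1
    congr 1
    funext i
    fin_cases i <;> rfl
  rw [h']
  exact tendsto_normalizedTrace_alternatingMonomial hc θ ε v

theorem state_limitN_pow (hc : AssumptionI μ c) (θ : ℝ) (k l : ℕ) :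
    (limitSpace hc θ).state (limitN hc θ ^ k * star (limitN hc θ) ^ l)
      = if k = l then (k.factorial : ℂ) else 0 := by
  rw [← starMonomialOne_replicate, ← alternatingMonomial_get _ (limitD hc θ),
    state_alternatingMonomial]
  have hnet : netExponent [] = 0 := rfl
  simp only [hnet, pairingIntegral_zero]
  rw [Finset.sum_const, Finset.card_univ, card_mixedPairPartition _ k l (card_get_replicate k l)
    (by simp)]
  simp

theorem isStdComplexGaussian_limitN (hc : AssumptionI μ c) (θ : ℝ) :
    IsStdComplexGaussian (limitSpace hc θ) (limitN hc θ) := by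
  refine ⟨fun h => ?_, ⟨Subtype.ext isStarNormal_circulant.star_comm_self⟩, fun k l => ?_⟩
  -- Self-adjointness would identify the second moments `φ(NN*) = 1` and `φ(N²) = 0`.
  · have h1 := state_limitN_pow hc θ 1 1
    have h2 := state_limitN_pow hc θ 2 0
    rw [h.star_eq] at h1 h2
    rw [pow_one, ← sq, if_pos rfl] at h1
    rw [pow_zero, mul_one, h1, if_neg (by norm_num)] at h2
    simp at h2
  · rw [state_limitN_pow, moment_stdComplexGaussianLaw]

theorem hasStarLaw_limitD (hc : AssumptionI μ c) (θ : ℝ) :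
    HasStarLaw (limitSpace hc θ) (limitD hc θ) (expUniformLaw θ) := by
  refine ⟨⟨Subtype.ext (isStarNormal_diagonal θ).star_comm_self⟩, fun k l => ?_⟩
  have h : limitD hc θ ^ k * star (limitD hc θ) ^ l
      = alternatingMonomial (limitN hc θ) (limitD hc θ) (Fin.elim0 : Fin 0 → Bool)
        (fun _ => List.replicate k false ++ List.replicate l true) := by
    simp [alternatingMonomial, starMonomialOne_replicate]
  -- With no letter `N`, the empty pairing is the only one.
  have hcard : Fintype.card (MixedPairPartition (Fin.elim0 : Fin 0 → Bool)) = 1 := by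
    rw [card_mixedPairPartition _ 0 0 (by simp) rfl]
    rfl
  obtain ⟨π, hπ⟩ := Fintype.card_eq_one_iff.1 hcard
  rw [h, state_alternatingMonomial, moment_expUniformLaw,
    Finset.sum_eq_single π (fun π' _ hne => absurd (hπ π') hne)
      (fun h => absurd (Finset.mem_univ _) h), pairingIntegral_of_isEmpty, netExponent_replicate]

end MatrixSequence

end LimitSpace

theorem theorem2p1 {Ω : Type*} [MeasurableSpace Ω] (μ : Measure Ω) [IsProbabilityMeasure μ]
    (c : ℕ → Ω → ℂ) (hc : AssumptionI μ c) (θ : ℝ) (hθ : θ ∈ Set.Icc (-Real.pi) Real.pi) :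
    ∃ (A : StarProbSpace.{0}) (N d : A.carrier),
      ConvergesInStarDistribution (fun n => randomMatrixSpace μ (n + 1))
        (fun n => ![scaledCirculant hc (n + 1), deterministicD μ θ (n + 1)]) A ![N, d] ∧
      IsStdComplexGaussian A N ∧
      HasStarLaw A d (expUniformLaw θ) ∧
      (∀ (p : ℕ) (ε : Fin p → Bool) (v : Fin (p + 1) → List Bool), Odd p →
        A.state (alternatingMonomial N d ε v) = 0) ∧
      (∀ (m : ℕ) (ε : Fin (2 * m) → Bool) (v : Fin (2 * m + 1) → List Bool),
        A.state (alternatingMonomial N d ε v)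
          = ∑ π : MixedPairPartition ε, pairingIntegral θ π fun r => netExponent (v r)) := by
  refine ⟨MatrixSequence.limitSpace hc θ, MatrixSequence.limitN hc θ, MatrixSequence.limitD hc θ,
    MatrixSequence.convergesInStarDistribution hc θ,
    MatrixSequence.isStdComplexGaussian_limitN hc θ, MatrixSequence.hasStarLaw_limitD hc θ,
    fun p ε v hp => ?_, fun m ε v => MatrixSequence.state_alternatingMonomial hc θ ε v⟩
  rw [MatrixSequence.state_alternatingMonomial]
  exact Finset.sum_eq_zero fun π _ => absurd π.1.even (Nat.not_even_iff_odd.2 hp)
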